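/- Let $k$ be a field; $\otimes=\otimes_k$ and all algebras and spaces are over $k$. A *quasi-bialgebra* is an associative unital algebra $H$ with algebra maps $\Delta:H\to H\otimes H$, $\varepsilon:H\to k$ and an invertible $\Phi\in H\otimes H\otimes H$ such that for all $h\in H$: $(\mathrm{id}\otimes\Delta)\Delta(h)=\Phi\,(\Delta\otimes\mathrm{id})\Delta(h)\,\Phi^{-1}$; $(\mathrm{id}\otimes\varepsilon)\Delta(h)=h\otimes1$ and $(\varepsilon\otimes\mathrm{id})\Delta(h)=1\otimes h$; $(1\otimes\Phi)(\mathrm{id}\otimes\Delta\otimes\mathrm{id})(\Phi)(\Phi\otimes1)=(\mathrm{id}\otimes\mathrm{id}\otimes\Delta)(\Phi)(\Delta\otimes\mathrm{id}\otimes\mathrm{id})(\Phi)$; and applying $\varepsilon$ to any one tensor factor of $\Phi$ gives $1\otimes 1$. Write $\Delta(h)=h_1\otimes h_2$, $\Phi=X^1\otimes X^2\otimes X^3=Y^1\otimes Y^2\otimes Y^3$, $\Phi^{-1}=x^1\otimes x^2\otimes x^3$. It is a *quasi-Hopf algebra* if there are an algebra anti-automorphism $S$ of $H$ and $\alpha,\beta\in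 H$ with $S(h_1)\alpha h_2=\varepsilon(h)\alpha$, $h_1\beta S(h_2)=\varepsilon(h)\beta$ for all $h$, and $X^1\beta S(X^2)\alpha X^3=1=S(x^1)\alpha x^2\beta S(x^3)$. Left $H$-modules form a monoidal category ${}_H\mathcal M$: $H$ acts on $U\otimes V$ through $\Delta$, the unit object is $k$ (via $\varepsilon$), and the associativity constraint is $a_{U,V,W}((u\otimes v)\otimes w)=X^1\cdot u\otimes(X^2\cdot v\otimes X^3\cdot w)$. A *left $H$-module algebra* is an algebra in ${}_H\mathcal M$: a left $H$-module $A$ with a bilinear multiplication and a two-sided unit $1_A$ such that $(aa')a''=(X^1\cdot a)[(X^2\cdot a')(X^3\cdot a'')]$, $h\cdot(aa')=(h_1\cdot a)(h_2\cdot a')$ and $h\cdot1_A=\varepsilon(h)1_A$. An isomorphism of left $H$-module algebras is a bijective $H$-linear map preserving products and units. *Smash product.* $A\# H$ is the associative unital algebra on $A\otimes H$ (with $a\# h:=a\otimes h$) with $(a\# h)(a'\# h')=(x^1\cdot a)(x^2h_1\cdot a')\# x^3h_2h'$ and unit $1_A\# 1$; the map $j:H\to A\# H$, $j(h)=1_A\#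 h$, is an algebra map. *The construction $B^v$.* For an associative unital algebra $B$ and an algebra map $v:H\to B$, $B^v$ is the space $B$ with $b\star b'=v(X^1)\,b\,v(S(x^1X^2)\alpha x^2X^3_1)\,b'\,v(S(x^3X^3_2))$, unit $v(\beta)$ and action $h\triangleright b=v(h_1)\,b\,v(S(h_2))$. Put $H_0=H^{\mathrm{id}_H}$. *Twisted tensor products.* Let $A,B$ be algebras in ${}_H\mathcal M$ with multiplications $\mu_A,\mu_B$. A *twisting map* is an $H$-linear map $R:B\otimes A\to A\otimes B$ with $R(b\otimes1_A)=1_A\otimes b$, $R(1_B\otimes a)=a\otimes1_B$ and $$R(\mu_B\otimes\mathrm{id}_A)=(\mathrm{id}_A\otimes\mu_B)\,a_{A,B,B}\,(R\otimes\mathrm{id}_B)\,a_{B,A,B}^{-1}\,(\mathrm{id}_B\otimes R)\,a_{B,B,A},$$ $$R(\mathrm{id}_B\otimes\mu_A)=(\mu_A\otimes\mathrm{id}_B)\,a_{A,A,B}^{-1}\,(\mathrm{id}_A\otimes R)\,a_{A,B,A}\,(R\otimes\mathrm{id}_A)\,a_{B,A,A}^{-1}.$$ The *twisted tensor product* $A\otimes_RB$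 is the $H$-module $A\otimes B$ with unit $1_A\otimes1_B$ and multiplication $$(\mu_A\otimes\mu_B)\,a_{A,A,B\otimes B}^{-1}\,(\mathrm{id}_A\otimes a_{A,B,B})\,(\mathrm{id}_A\otimes R\otimes\mathrm{id}_B)\,(\mathrm{id}_A\otimes a_{B,A,B}^{-1})\,a_{A,B,A\otimes B}.$$ *The algebra $A\diamond H_0$.* Let $B^1\otimes B^2\otimes B^3\otimes B^4=(\Delta\otimes\mathrm{id}\otimes\mathrm{id})(\Phi)(\Phi^{-1}\otimes1)$, $\delta=B^1\beta S(B^4)\otimes B^2\beta S(B^3)$, $g^1\otimes g^2=\Delta(S(x^1)\alpha x^2)\,\delta\,(S(x^3_2)\otimes S(x^3_1))$ and $q^1\otimes q^2=X^1\otimes S^{-1}(\alpha X^3)X^2$. For a left $H$-module algebra $A$ put $A\diamond H_0=A\otimes_RH_0$, where $R:H_0\otimes A\to A\otimes H_0$ is $$R(h\otimes a)=X^1Y^1_1h_1g^1S(q^2Y^2_2)Y^3\cdot a\;\otimes\;X^2Y^1_2h_2g^2S(X^3q^1Y^2_1).$$ **Proposition.** Let $H$ be a quasi-Hopf algebra over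 $k$ and $A$ a left $H$-module algebra. Then $H_0$ is a left $H$-module algebra and $R$ is a twisting map between $A$ and $H_0$ in ${}_H\mathcal M$; $A\diamond H_0$ and $(A\# H)^j$ are left $H$-module algebras; and the map $$\Pi:A\diamond H_0\to(A\# H)^j,\qquad \Pi(a\otimes h)=x^1\cdot a\,\#\,x^2hS(x^3),$$ is an isomorphism of left $H$-module algebras. -/

import Mathlib

open scoped TensorProduct

namespace QuasiHopf

noncomputable section

universe u v w

set_option linter.unusedSectionVars false
set_option linter.unusedSimpArgs false

/-! Shortcut instances for iterated tensor products; they only help instance resolution and are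
definitionally the instances of `Algebra.TensorProduct`. -/

section Shortcuts

variable {k : Type u} {H : Type v} [Field k] [Ring H] [Algebra k H]

instance instSemiring4 : Semiring (H ⊗[k] (H ⊗[k] (H ⊗[k] H))) :=
  Algebra.TensorProduct.instSemiring

instance instNonUnital4 : NonUnitalNonAssocSemiring (H ⊗[k] (H ⊗[k] (H ⊗[k] H))) :=
  instSemiring4.toNonUnitalSemiring.toNonUnitalNonAssocSemiring

instance instMonoid4 : Monoid (H ⊗[k] (H ⊗[k] (H ⊗[k] H))) :=
  instSemiring4.toMonoidWithZero.toMonoid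

instance instNonAssoc4 : NonAssocSemiring (H ⊗[k] (H ⊗[k] (H ⊗[k] H))) :=
  instSemiring4.toNonAssocSemiring

instance instDistrib4 : Distrib (H ⊗[k] (H ⊗[k] (H ⊗[k] H))) :=
  instNonUnital4.toDistrib

instance instMulZero4 : MulZeroClass (H ⊗[k] (H ⊗[k] (H ⊗[k] H))) :=
  instNonUnital4.toMulZeroClass

instance instOneHom34 : OneHomClass (H ⊗[k] (H ⊗[k] H) →ₐ[k] H ⊗[k] (H ⊗[k] (H ⊗[k] H)))
    (H ⊗[k] (H ⊗[k] H)) (H ⊗[k] (H ⊗[k] (H ⊗[k] H))) :=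
  ⟨fun F => F.map_one'⟩

instance instSMulComm3 : SMulCommClass k (H ⊗[k] (H ⊗[k] H)) (H ⊗[k] (H ⊗[k] H)) :=
  ⟨fun c X Y => (Algebra.mul_smul_comm c X Y).symm⟩

instance instScalarTower3 : IsScalarTower k (H ⊗[k] (H ⊗[k] H)) (H ⊗[k] (H ⊗[k] H)) :=
  ⟨fun c X Y => Algebra.smul_mul_assoc c X Y⟩

end Shortcuts

/-! ## Quasi-bialgebras and quasi-Hopf algebras

Triple and quadruple tensor products are bracketed to the right:
`H ⊗ (H ⊗ H)` and `H ⊗ (H ⊗ (H ⊗ H))`. -/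

section Tensors

variable {k : Type u} {H : Type v} [Field k] [Ring H] [Algebra k H]

/-- `x ⊗ (y ⊗ z) ↦ D x ⊗ (y ⊗ z)`, i.e. `D ⊗ id ⊗ id`, rebracketed. -/
def slot1 (D : H →ₐ[k] H ⊗[k] H) :
    H ⊗[k] (H ⊗[k] H) →ₐ[k] H ⊗[k] (H ⊗[k] (H ⊗[k] H)) :=
  (Algebra.TensorProduct.assoc k k k H H (H ⊗[k] H)).toAlgHom.comp
    (Algebra.TensorProduct.map D (AlgHom.id k (H ⊗[k] H)))

/-- `x ⊗ y ↦ D x ⊗ y`, i.e. `D ⊗ id`, rebracketed. -/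
def tensorLeft (D : H →ₐ[k] H ⊗[k] H) : H ⊗[k] H →ₐ[k] H ⊗[k] (H ⊗[k] H) :=
  (Algebra.TensorProduct.assoc k k k H H H).toAlgHom.comp
    (Algebra.TensorProduct.map D (AlgHom.id k H))

/-- `x ⊗ y ↦ x ⊗ D y`, i.e. `id ⊗ D`. -/
def tensorRight (D : H →ₐ[k] H ⊗[k] H) : H ⊗[k] H →ₐ[k] H ⊗[k] (H ⊗[k] H) :=
  Algebra.TensorProduct.map (AlgHom.id k H) D

/-- `x ⊗ (y ⊗ z) ↦ x ⊗ (D y ⊗ z)`, i.e. `id ⊗ D ⊗ id`, rebracketed. -/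
def slot2 (D : H →ₐ[k] H ⊗[k] H) :
    H ⊗[k] (H ⊗[k] H) →ₐ[k] H ⊗[k] (H ⊗[k] (H ⊗[k] H)) :=
  Algebra.TensorProduct.map (AlgHom.id k H) (tensorLeft D)

/-- `x ⊗ (y ⊗ z) ↦ x ⊗ (y ⊗ D z)`, i.e. `id ⊗ id ⊗ D`. -/
def slot3 (D : H →ₐ[k] H ⊗[k] H) :
    H ⊗[k] (H ⊗[k] H) →ₐ[k] H ⊗[k] (H ⊗[k] (H ⊗[k] H)) :=
  Algebra.TensorProduct.map (AlgHom.id k H) (tensorRight D)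

variable (k H) in
/-- `T ↦ 1 ⊗ T`. -/
def padLeft : H ⊗[k] (H ⊗[k] H) →ₐ[k] H ⊗[k] (H ⊗[k] (H ⊗[k] H)) :=
  Algebra.TensorProduct.includeRight

variable (k H) in
/-- `T ↦ T ⊗ 1`, rebracketed: `x ⊗ (y ⊗ z) ↦ x ⊗ (y ⊗ (z ⊗ 1))`. -/
def padRight : H ⊗[k] (H ⊗[k] H) →ₐ[k] H ⊗[k] (H ⊗[k] (H ⊗[k] H)) :=
  Algebra.TensorProduct.map (AlgHom.id k H)
    (Algebra.TensorProduct.map (AlgHom.id k H) Algebra.TensorProduct.includeLeft)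

variable {P : Type*} [Ring P] [Algebra k P]

/-- The linear map `x ⊗ y ↦ f x * g y`. -/
def prod2 {M N : Type*} [AddCommGroup M] [Module k M] [AddCommGroup N] [Module k N]
    (f : M →ₗ[k] P) (g : N →ₗ[k] P) : M ⊗[k] N →ₗ[k] P :=
  LinearMap.mul' k P ∘ₗ TensorProduct.map f g

/-- The linear map `x ⊗ y ↦ (p ↦ f x * p * g y)`; so `sandwich f g T p` is the expression
`f(T¹) p g(T²)`. -/
def sandwich {M N : Type*} [AddCommGroup M] [Module k M] [AddCommGroup N] [Module k N]
    (f : M →ₗ[k] P) (g : N →ₗ[k] P) : M ⊗[k] N →ₗ[k] Module.End k P :=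
  prod2 (P := Module.End k P) (LinearMap.mul k P ∘ₗ f) ((LinearMap.mul k P).flip ∘ₗ g)

theorem prod2_tmul {M N : Type*} [AddCommGroup M] [Module k M] [AddCommGroup N] [Module k N]
    (f : M →ₗ[k] P) (g : N →ₗ[k] P) (x : M) (y : N) : prod2 f g (x ⊗ₜ[k] y) = f x * g y := by
  simp [prod2]

theorem sandwich_tmul {M N : Type*} [AddCommGroup M] [Module k M] [AddCommGroup N] [Module k N]
    (f : M →ₗ[k] P) (g : N →ₗ[k] P) (x : M) (y : N) (p : P) :
    sandwich f g (x ⊗ₜ[k] y) p = f x * p * g y := by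
  simp [sandwich, prod2_tmul, mul_assoc]

end Tensors

/-- A quasi-bialgebra structure on an associative unital algebra `H` over a field `k`. -/
class QuasiBialgebra (k : Type u) (H : Type v) [Field k] [Ring H] [Algebra k H] where
  /-- the comultiplication `Δ` -/
  comul : H →ₐ[k] H ⊗[k] H
  /-- the counit `ε` -/
  counit : H →ₐ[k] k
  /-- the reassociator `Φ`, with its inverse -/
  reassociator : (H ⊗[k] (H ⊗[k] H))ˣ
  /-- `(id ⊗ Δ)(Δ h) = Φ (Δ ⊗ id)(Δ h) Φ⁻¹` -/
  quasi_coassoc : ∀ h : H, tensorRight comul (comul h) =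
    (reassociator : H ⊗[k] (H ⊗[k] H)) * tensorLeft comul (comul h) *
      ((reassociator⁻¹ : (H ⊗[k] (H ⊗[k] H))ˣ) : H ⊗[k] (H ⊗[k] H))
  /-- `(id ⊗ ε)(Δ h) = h ⊗ 1` -/
  counit_right : ∀ h : H,
    Algebra.TensorProduct.map (AlgHom.id k H) counit (comul h) = h ⊗ₜ[k] (1 : k)
  /-- `(ε ⊗ id)(Δ h) = 1 ⊗ h` -/
  counit_left : ∀ h : H,
    Algebra.TensorProduct.map counit (AlgHom.id k H) (comul h) = (1 : k) ⊗ₜ[k] h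
  /-- `(1 ⊗ Φ)(id ⊗ Δ ⊗ id)(Φ)(Φ ⊗ 1) = (id ⊗ id ⊗ Δ)(Φ)(Δ ⊗ id ⊗ id)(Φ)` -/
  pentagon : padLeft k H reassociator * slot2 comul reassociator * padRight k H reassociator =
    slot3 comul reassociator * slot1 comul reassociator
  /-- `(ε ⊗ id ⊗ id)(Φ) = 1` -/
  reassociator_counit₁ :
    Algebra.TensorProduct.map counit (AlgHom.id k (H ⊗[k] H)) reassociator = 1
  /-- `(id ⊗ ε ⊗ id)(Φ) = 1` -/
  reassociator_counit₂ :
    Algebra.TensorProduct.map (AlgHom.id k H)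
      (Algebra.TensorProduct.map counit (AlgHom.id k H)) reassociator = 1
  /-- `(id ⊗ id ⊗ ε)(Φ) = 1` -/
  reassociator_counit₃ :
    Algebra.TensorProduct.map (AlgHom.id k H)
      (Algebra.TensorProduct.map (AlgHom.id k H) counit) reassociator = 1

section Abbreviations

variable (k : Type u) (H : Type v) [Field k] [Ring H] [Algebra k H] [QuasiBialgebra k H]

/-- the comultiplication `Δ(h) = h₁ ⊗ h₂` -/
abbrev Δ : H →ₐ[k] H ⊗[k] H := QuasiBialgebra.comul

/-- the counit -/
abbrev ε : H →ₐ[k] k := QuasiBialgebra.counit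

/-- the reassociator `Φ = X¹ ⊗ X² ⊗ X³` -/
abbrev Φ : H ⊗[k] (H ⊗[k] H) :=
  ((QuasiBialgebra.reassociator : (H ⊗[k] (H ⊗[k] H))ˣ) : H ⊗[k] (H ⊗[k] H))

/-- the inverse of the reassociator, `Φ⁻¹ = x¹ ⊗ x² ⊗ x³` -/
abbrev Φinv : H ⊗[k] (H ⊗[k] H) :=
  (((QuasiBialgebra.reassociator : (H ⊗[k] (H ⊗[k] H))ˣ)⁻¹ : (H ⊗[k] (H ⊗[k] H))ˣ) :
    H ⊗[k] (H ⊗[k] H))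

end Abbreviations

/-- A quasi-Hopf algebra: a quasi-bialgebra with an anti-automorphism `S` and elements
`α`, `β`. No normalization of `ε(α)`, `ε(β)` is imposed. -/
class QuasiHopfAlgebra (k : Type u) (H : Type v) [Field k] [Ring H] [Algebra k H]
    extends QuasiBialgebra k H where
  /-- the antipode, a bijective linear map -/
  antipode : H ≃ₗ[k] H
  antipode_one : antipode 1 = 1
  antipode_mul : ∀ x y : H, antipode (x * y) = antipode y * antipode x
  /-- the element `α` -/
  elemα : H
  /-- the element `β` -/
  elemβ : H
  /-- `S(h₁) α h₂ = ε(h) α` -/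
  antipode_left : ∀ h : H,
    sandwich antipode.toLinearMap LinearMap.id (comul h) elemα = counit h • elemα
  /-- `h₁ β S(h₂) = ε(h) β` -/
  antipode_right : ∀ h : H,
    sandwich LinearMap.id antipode.toLinearMap (comul h) elemβ = counit h • elemβ
  /-- `X¹ β (S(X²) α X³) = 1` -/
  reassociator_antipode :
    sandwich LinearMap.id
      (prod2 (LinearMap.mulRight k elemα ∘ₗ antipode.toLinearMap) LinearMap.id)
      (reassociator : H ⊗[k] (H ⊗[k] H)) elemβ = 1
  /-- `S(x¹) α (x² β S(x³)) = 1` -/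
  reassociator_inv_antipode :
    sandwich antipode.toLinearMap
      (prod2 (LinearMap.mulRight k elemβ) antipode.toLinearMap)
      ((reassociator⁻¹ : (H ⊗[k] (H ⊗[k] H))ˣ) : H ⊗[k] (H ⊗[k] H)) elemα = 1

section HopfElements

variable (k : Type u) (H : Type v) [Field k] [Ring H] [Algebra k H] [QuasiHopfAlgebra k H]

/-- the antipode as a linear map -/
abbrev S : H →ₗ[k] H :=
  (QuasiHopfAlgebra.antipode : H ≃ₗ[k] H).toLinearMap

/-- the inverse of the antipode as a linear map -/
abbrev Sinv : H →ₗ[k] H :=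
  (QuasiHopfAlgebra.antipode : H ≃ₗ[k] H).symm.toLinearMap

/-- the element `α` -/
abbrev α : H := QuasiHopfAlgebra.elemα (k := k)

/-- the element `β` -/
abbrev β : H := QuasiHopfAlgebra.elemβ (k := k)

/-- The linear map `x ⊗ y ↦ S(x) α y`. -/
def antiα : H ⊗[k] H →ₗ[k] H :=
  prod2 (LinearMap.mulRight k (α k H) ∘ₗ S k H) LinearMap.id

/-- The linear map `x ⊗ y ↦ S(y) ⊗ S(x)`, so that `flipS (Δ h) = (S ⊗ S)(Δ^cop(h))`. -/
def flipS : H ⊗[k] H →ₗ[k] H ⊗[k] H :=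
  TensorProduct.map (S k H) (S k H) ∘ₗ (TensorProduct.comm k H H).toLinearMap

/-- `B¹ ⊗ B² ⊗ B³ ⊗ B⁴ = (Δ ⊗ id ⊗ id)(Φ)(Φ⁻¹ ⊗ 1)` -/
def elemB : H ⊗[k] (H ⊗[k] (H ⊗[k] H)) :=
  slot1 (Δ k H) (Φ k H) * padRight k H (Φinv k H)

/-- `δ = B¹ β S(B⁴) ⊗ B² β S(B³)`, written as
`(B¹ ⊗ B²) (β ⊗ β) (S(B⁴) ⊗ S(B³))` in `H ⊗ H`. -/
def elemδ : H ⊗[k] H :=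
  sandwich LinearMap.id (flipS k H) ((TensorProduct.assoc k H H (H ⊗[k] H)).symm (elemB k H))
    (β k H ⊗ₜ[k] β k H)

/-- `f⁻¹ = g¹ ⊗ g² = Δ(S(x¹) α x²) δ (S ⊗ S)(Δ^cop(x³))`, the inverse of the canonical gauge
transformation `f`. -/
def elemg : H ⊗[k] H :=
  sandwich ((Δ k H).toLinearMap ∘ₗ antiα k H) (flipS k H ∘ₗ (Δ k H).toLinearMap)
    ((TensorProduct.assoc k H H H).symm (Φinv k H)) (elemδ k H)

/-- `q_R = q¹ ⊗ q² = X¹ ⊗ S⁻¹(α X³) X²` -/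
def elemq : H ⊗[k] H :=
  TensorProduct.map LinearMap.id
    (prod2 (Sinv k H ∘ₗ LinearMap.mulLeft k (α k H)) LinearMap.id ∘ₗ
      (TensorProduct.comm k H H).toLinearMap) (Φ k H)

/-- The linear map `H → H ⊗ H`,
`h ↦ h₍₋₁₎ ⊗ h₍₀₎ = X¹ Y¹₁ h₁ g¹ S(q² Y²₂) Y³ ⊗ X² Y¹₂ h₂ g² S(X³ q¹ Y²₁)`,
written as `(X¹ ⊗ X²) [Δ(Y¹) (Δ(h) f⁻¹) (S(q² Y²₂) ⊗ S(q¹ Y²₁)) (Y³ ⊗ 1)] (1 ⊗ S(X³))`. -/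
def coactH0 : H →ₗ[k] H ⊗[k] H :=
  sandwich LinearMap.id
      ((Algebra.TensorProduct.includeRight : H →ₐ[k] H ⊗[k] H).toLinearMap ∘ₗ S k H)
      ((TensorProduct.assoc k H H H).symm (Φ k H)) ∘ₗ
    sandwich (Δ k H).toLinearMap
      (prod2 (flipS k H ∘ₗ LinearMap.mulLeft k (elemq k H) ∘ₗ (Δ k H).toLinearMap)
        (Algebra.TensorProduct.includeLeft : H →ₐ[k] H ⊗[k] H).toLinearMap) (Φ k H) ∘ₗ
    LinearMap.mulRight k (elemg k H) ∘ₗ (Δ k H).toLinearMap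

/-- `X¹ ⊗ S(x¹ X²) α x² X³₁ ⊗ S(x³ X³₂)` -/
def elemΘ : H ⊗[k] (H ⊗[k] H) :=
  TensorProduct.map LinearMap.id
    (TensorProduct.map (antiα k H) (S k H) ∘ₗ (TensorProduct.assoc k H H H).symm.toLinearMap)
    (padLeft k H (Φinv k H) * slot3 (Δ k H) (Φ k H))

end HopfElements

/-! ## The monoidal category of left `H`-modules and its algebras

A left `H`-module structure on a vector space `M` is an algebra homomorphism
`H →ₐ[k] Module.End k M`. -/

section Modules

variable {k : Type u} {H : Type v} [Field k] [Ring H] [Algebra k H] [QuasiBialgebra k H]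
variable {M N L : Type*} [AddCommGroup M] [Module k M] [AddCommGroup N] [Module k N]
  [AddCommGroup L] [Module k L]

/-- The action `h · (m ⊗ n) = h₁ · m ⊗ h₂ · n` on the tensor product of two left `H`-modules. -/
def tensorAct (ρ : H →ₐ[k] Module.End k M) (σ : H →ₐ[k] Module.End k N) :
    H →ₐ[k] Module.End k (M ⊗[k] N) :=
  Module.endTensorEndAlgHom.comp ((Algebra.TensorProduct.map ρ σ).comp (Δ k H))

/-- The action of `H ⊗ (H ⊗ H)` on `M ⊗ (N ⊗ L)`, factor by factor. -/
def tripleAct (ρ : H →ₐ[k] Module.End k M) (σ : H →ₐ[k] Module.End k N)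
    (τ : H →ₐ[k] Module.End k L) :
    H ⊗[k] (H ⊗[k] H) →ₐ[k] Module.End k (M ⊗[k] (N ⊗[k] L)) :=
  Module.endTensorEndAlgHom.comp (Algebra.TensorProduct.map ρ
    (Module.endTensorEndAlgHom.comp (Algebra.TensorProduct.map σ τ)))

/-- The associativity constraint `(M ⊗ N) ⊗ L ≃ M ⊗ (N ⊗ L)`,
`(m ⊗ n) ⊗ l ↦ X¹ · m ⊗ (X² · n ⊗ X³ · l)`. -/
def associator (ρ : H →ₐ[k] Module.End k M) (σ : H →ₐ[k] Module.End k N)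
    (τ : H →ₐ[k] Module.End k L) : (M ⊗[k] N) ⊗[k] L ≃ₗ[k] M ⊗[k] (N ⊗[k] L) :=
  (TensorProduct.assoc k M N L).trans
    (LinearMap.GeneralLinearGroup.generalLinearEquiv k _
      (Units.map (tripleAct ρ σ τ : H ⊗[k] (H ⊗[k] H) →* Module.End k (M ⊗[k] (N ⊗[k] L)))
        QuasiBialgebra.reassociator))

theorem tensorAct_apply (ρ : H →ₐ[k] Module.End k M) (σ : H →ₐ[k] Module.End k N) (h : H) :
    tensorAct ρ σ h =
      Module.endTensorEndAlgHom (S := k) (Algebra.TensorProduct.map ρ σ (Δ k H h)) :=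
  rfl

theorem tripleAct_tmul (ρ : H →ₐ[k] Module.End k M) (σ : H →ₐ[k] Module.End k N)
    (τ : H →ₐ[k] Module.End k L) (x y z : H) (m : M) (n : N) (l : L) :
    tripleAct ρ σ τ (x ⊗ₜ[k] (y ⊗ₜ[k] z)) (m ⊗ₜ[k] (n ⊗ₜ[k] l)) =
      ρ x m ⊗ₜ[k] (σ y n ⊗ₜ[k] τ z l) :=
  rfl

theorem associator_tmul (ρ : H →ₐ[k] Module.End k M) (σ : H →ₐ[k] Module.End k N)
    (τ : H →ₐ[k] Module.End k L) (m : M) (n : N) (l : L) :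
    associator ρ σ τ ((m ⊗ₜ[k] n) ⊗ₜ[k] l) =
      tripleAct ρ σ τ (Φ k H) (m ⊗ₜ[k] (n ⊗ₜ[k] l)) :=
  rfl

end Modules

/-- A left `H`-module `A` with a bilinear multiplication and a distinguished element. The axioms
of a left `H`-module algebra are in `HModuleData.IsModuleAlgebra`. -/
structure HModuleData (k : Type u) (H : Type v) (A : Type w) [Field k] [Ring H] [Algebra k H]
    [AddCommGroup A] [Module k A] where
  /-- the left action of `H` -/
  act : H →ₐ[k] Module.End k A
  /-- the multiplication -/
  mul : A →ₗ[k] A →ₗ[k] A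
  /-- the unit -/
  one : A

section ModuleAlgebras

variable {k : Type u} {H : Type v} [Field k] [Ring H] [Algebra k H]
variable {A : Type*} [AddCommGroup A] [Module k A] {B : Type*} [AddCommGroup B] [Module k B]

/-- The multiplication as a linear map `A ⊗ A → A`. -/
def HModuleData.μ (𝒜 : HModuleData k H A) : A ⊗[k] A →ₗ[k] A := TensorProduct.lift 𝒜.mul

/-- `𝒜` is a left `H`-module algebra, i.e. an algebra in the monoidal category of left
`H`-modules. -/
structure HModuleData.IsModuleAlgebra [QuasiBialgebra k H] (𝒜 : HModuleData k H A) : Prop where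
  /-- `(a b) c = (X¹ · a) [(X² · b) (X³ · c)]` -/
  mul_assoc : ∀ a b c : A, 𝒜.mul (𝒜.mul a b) c =
    𝒜.μ (𝒜.μ.lTensor A (associator 𝒜.act 𝒜.act 𝒜.act ((a ⊗ₜ[k] b) ⊗ₜ[k] c)))
  one_mul : ∀ a : A, 𝒜.mul 𝒜.one a = a
  mul_one : ∀ a : A, 𝒜.mul a 𝒜.one = a
  /-- `h · (a b) = (h₁ · a) (h₂ · b)` -/
  act_mul : ∀ (h : H) (a b : A),
    𝒜.act h (𝒜.mul a b) = 𝒜.μ (tensorAct 𝒜.act 𝒜.act h (a ⊗ₜ[k] b))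
  /-- `h · 1 = ε(h) 1` -/
  act_one : ∀ h : H, 𝒜.act h 𝒜.one = ε k H h • 𝒜.one

/-- `f` is an isomorphism of left `H`-module algebras: bijective, `H`-linear, multiplicative and
unital. -/
structure IsModuleAlgebraIso (𝒜 : HModuleData k H A) (ℬ : HModuleData k H B) (f : A →ₗ[k] B) :
    Prop where
  bijective : Function.Bijective f
  map_act : ∀ (h : H) (a : A), f (𝒜.act h a) = ℬ.act h (f a)
  map_mul : ∀ a b : A, f (𝒜.mul a b) = ℬ.mul (f a) (f b)
  map_one : f 𝒜.one = ℬ.one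

variable [QuasiBialgebra k H]

/-- `R : B ⊗ A → A ⊗ B` is a twisting map between `𝒜` and `ℬ` in the category of left
`H`-modules. -/
structure IsTwistingMap (𝒜 : HModuleData k H A) (ℬ : HModuleData k H B)
    (R : B ⊗[k] A →ₗ[k] A ⊗[k] B) : Prop where
  /-- `R` is a morphism of left `H`-modules -/
  map_act : ∀ (h : H) (t : B ⊗[k] A),
    R (tensorAct ℬ.act 𝒜.act h t) = tensorAct 𝒜.act ℬ.act h (R t)
  map_unit_right : ∀ b : B, R (b ⊗ₜ[k] 𝒜.one) = 𝒜.one ⊗ₜ[k] b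
  map_unit_left : ∀ a : A, R (ℬ.one ⊗ₜ[k] a) = a ⊗ₜ[k] ℬ.one
  /-- `R (μ_B ⊗ id) = (id ⊗ μ_B) a_{A,B,B} (R ⊗ id) a_{B,A,B}⁻¹ (id ⊗ R) a_{B,B,A}` -/
  map_mul_left :
    R ∘ₗ ℬ.μ.rTensor A =
      ℬ.μ.lTensor A ∘ₗ (associator 𝒜.act ℬ.act ℬ.act).toLinearMap ∘ₗ R.rTensor B ∘ₗ
        (associator ℬ.act 𝒜.act ℬ.act).symm.toLinearMap ∘ₗ R.lTensor B ∘ₗ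
        (associator ℬ.act ℬ.act 𝒜.act).toLinearMap
  /-- `R (id ⊗ μ_A) = (μ_A ⊗ id) a_{A,A,B}⁻¹ (id ⊗ R) a_{A,B,A} (R ⊗ id) a_{B,A,A}⁻¹` -/
  map_mul_right :
    R ∘ₗ 𝒜.μ.lTensor B =
      𝒜.μ.rTensor B ∘ₗ (associator 𝒜.act 𝒜.act ℬ.act).symm.toLinearMap ∘ₗ R.lTensor A ∘ₗ
        (associator 𝒜.act ℬ.act 𝒜.act).toLinearMap ∘ₗ R.rTensor A ∘ₗ
        (associator ℬ.act 𝒜.act 𝒜.act).symm.toLinearMap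

/-- The twisted tensor product `A ⊗_R B` in the category of left `H`-modules: the action is
`h · (a ⊗ b) = h₁ · a ⊗ h₂ · b`, the unit is `1 ⊗ 1` and the multiplication is the composite
`(μ_A ⊗ μ_B) a_{A,A,B⊗B}⁻¹ (id ⊗ a_{A,B,B}) (id ⊗ R ⊗ id) (id ⊗ a_{B,A,B}⁻¹) a_{A,B,A⊗B}`. -/
def twistedTensor (𝒜 : HModuleData k H A) (ℬ : HModuleData k H B)
    (R : B ⊗[k] A →ₗ[k] A ⊗[k] B) : HModuleData k H (A ⊗[k] B) where
  act := tensorAct 𝒜.act ℬ.act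
  mul := TensorProduct.curry (TensorProduct.map 𝒜.μ ℬ.μ ∘ₗ
    (associator 𝒜.act 𝒜.act (tensorAct ℬ.act ℬ.act)).symm.toLinearMap ∘ₗ
    (associator 𝒜.act ℬ.act ℬ.act).toLinearMap.lTensor A ∘ₗ
    (R.rTensor B).lTensor A ∘ₗ
    (associator ℬ.act 𝒜.act ℬ.act).symm.toLinearMap.lTensor A ∘ₗ
    (associator 𝒜.act ℬ.act (tensorAct 𝒜.act ℬ.act)).toLinearMap)
  one := 𝒜.one ⊗ₜ[k] ℬ.one

end ModuleAlgebras

/-! ## The module algebras `B^v`, `H₀` and `A ◇ H₀` -/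

section Induced

variable {k : Type u} {H : Type v} [Field k] [Ring H] [Algebra k H] [QuasiHopfAlgebra k H]
variable {A : Type*} [AddCommGroup A] [Module k A] {B : Type*} [Ring B] [Algebra k B]

/-- The action `h ▷ b = v(h₁) b v(S(h₂))`. -/
def inducedAct (v : H →ₐ[k] B) : H →ₐ[k] Module.End k B :=
  AlgHom.ofLinearMap
    (sandwich v.toLinearMap (v.toLinearMap ∘ₗ S k H) ∘ₗ (Δ k H).toLinearMap)
    (by
      ext b
      simp [Algebra.TensorProduct.one_def, sandwich_tmul, QuasiHopfAlgebra.antipode_one])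
    (by
      have key : ∀ s t : H ⊗[k] H, sandwich v.toLinearMap (v.toLinearMap ∘ₗ S k H) (s * t) =
          sandwich v.toLinearMap (v.toLinearMap ∘ₗ S k H) s *
            sandwich v.toLinearMap (v.toLinearMap ∘ₗ S k H) t := by
        intro s t
        induction s with
        | zero => simp
        | add x y hx hy => simp only [add_mul, map_add, hx, hy]
        | tmul x y =>
          induction t with
          | zero => simp
          | add x y hx hy => simp only [mul_add, map_add, hx, hy]
          | tmul x' y' =>
            ext b
            simp [sandwich_tmul, QuasiHopfAlgebra.antipode_mul, mul_assoc]
      intro x y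
      simp [key])

/-- The product `b ⋆ b' = v(X¹) b v(S(x¹ X²) α x² X³₁) b' v(S(x³ X³₂))`. -/
def inducedMul (v : H →ₐ[k] B) : B →ₗ[k] B →ₗ[k] B :=
  LinearMap.mk₂ k
    (fun b b' => sandwich v.toLinearMap
      (prod2 (LinearMap.mulRight k b' ∘ₗ v.toLinearMap) v.toLinearMap) (elemΘ k H) b)
    (fun b₁ b₂ b' => map_add _ _ _)
    (fun c b b' => map_smul _ _ _)
    (fun b b₁ b₂ => by
      induction elemΘ k H with
      | zero => simp
      | add x y hx hy => simp only [map_add, LinearMap.add_apply, hx, hy]; abel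
      | tmul x y =>
        simp only [sandwich_tmul]
        rw [← mul_add]
        congr 1
        induction y with
        | zero => simp
        | add x y hx hy => simp only [map_add, hx, hy]; abel
        | tmul y z => simp [prod2_tmul, mul_add, add_mul])
    (fun c b b' => by
      induction elemΘ k H with
      | zero => simp
      | add x y hx hy => simp only [map_add, LinearMap.add_apply, hx, hy, smul_add]
      | tmul x y =>
        simp only [sandwich_tmul]
        rw [← mul_smul_comm]
        congr 1
        induction y with
        | zero => simp
        | add x y hx hy => simp only [map_add, hx, hy, smul_add]
        | tmul y z => simp [prod2_tmul])

/-- The structure `B^v` on an associative algebra `B` with an algebra map `v : H → B`. -/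
def induced (v : H →ₐ[k] B) : HModuleData k H B where
  act := inducedAct v
  mul := inducedMul v
  one := v (β k H)

variable (k H) in
/-- `H₀ = H^id` -/
def H0 : HModuleData k H H := induced (AlgHom.id k H)

/-- The map `R : H₀ ⊗ A → A ⊗ H₀`, `R(h ⊗ a) = h₍₋₁₎ · a ⊗ h₍₀₎`. -/
def diamondTwist (𝒜 : HModuleData k H A) : H ⊗[k] A →ₗ[k] A ⊗[k] H :=
  TensorProduct.lift (LinearMap.mk₂ k
    (fun h a => TensorProduct.map (𝒜.act.toLinearMap.flip a) LinearMap.id (coactH0 k H h))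
    (fun h₁ h₂ a => by simp)
    (fun c h a => by simp)
    (fun h a₁ a₂ => by simp [TensorProduct.map_add_left])
    (fun c h a => by simp [TensorProduct.map_smul_left]))

/-- `A ◇ H₀`, the twisted tensor product of `A` and `H₀` in the category of left `H`-modules. -/
def diamond (𝒜 : HModuleData k H A) : HModuleData k H (A ⊗[k] H) :=
  twistedTensor 𝒜 (H0 k H) (diamondTwist 𝒜)

end Induced

/-! ## The smash product -/

section Smash

variable {k : Type u} {H : Type v} [Field k] [Ring H] [Algebra k H]
variable {A : Type*} [AddCommGroup A] [Module k A]

/-- The linear map `T ↦ (T¹ · a) (T² · a') ⊗ T³`. -/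
def smashTri (𝒜 : HModuleData k H A) (a a' : A) : H ⊗[k] (H ⊗[k] H) →ₗ[k] A ⊗[k] H :=
  TensorProduct.map
      (𝒜.μ ∘ₗ TensorProduct.map (𝒜.act.toLinearMap.flip a) (𝒜.act.toLinearMap.flip a'))
      LinearMap.id ∘ₗ
    (TensorProduct.assoc k H H H).symm.toLinearMap

theorem smashTri_tmul (𝒜 : HModuleData k H A) (a a' : A) (x y z : H) :
    smashTri 𝒜 a a' (x ⊗ₜ[k] (y ⊗ₜ[k] z)) =
      𝒜.mul (𝒜.act x a) (𝒜.act y a') ⊗ₜ[k] z := by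
  simp [smashTri, HModuleData.μ]

theorem smashTri_add_left (𝒜 : HModuleData k H A) (a b a' : A) :
    smashTri 𝒜 (a + b) a' = smashTri 𝒜 a a' + smashTri 𝒜 b a' := by
  ext x y z
  simp [smashTri_tmul, TensorProduct.add_tmul]

theorem smashTri_add_right (𝒜 : HModuleData k H A) (a b a' : A) :
    smashTri 𝒜 a' (a + b) = smashTri 𝒜 a' a + smashTri 𝒜 a' b := by
  ext x y z
  simp [smashTri_tmul, TensorProduct.add_tmul]

theorem smashTri_smul_left (𝒜 : HModuleData k H A) (c : k) (a a' : A) :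
    smashTri 𝒜 (c • a) a' = c • smashTri 𝒜 a a' := by
  ext x y z
  simp [smashTri_tmul, TensorProduct.smul_tmul']

theorem smashTri_smul_right (𝒜 : HModuleData k H A) (c : k) (a a' : A) :
    smashTri 𝒜 a (c • a') = c • smashTri 𝒜 a a' := by
  ext x y z
  simp [smashTri_tmul, TensorProduct.smul_tmul']

variable [QuasiBialgebra k H]

/-- The smash product multiplication
`(a # h) (a' # h') = (x¹ · a) (x² h₁ · a') # x³ h₂ h'`. -/
def smashMul (𝒜 : HModuleData k H A) : A ⊗[k] H →ₗ[k] A ⊗[k] H →ₗ[k] A ⊗[k] H :=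
  TensorProduct.lift (LinearMap.mk₂ k
    (fun a h => TensorProduct.lift (LinearMap.mk₂ k
      (fun a' h' => smashTri 𝒜 a a' (Φinv k H * (1 ⊗ₜ[k] (Δ k H h * (1 ⊗ₜ[k] h')))))
      (fun a₁ a₂ h' => by simp [smashTri_add_right])
      (fun c a' h' => by simp [smashTri_smul_right])
      (fun a' h₁ h₂ => by simp [TensorProduct.tmul_add, mul_add])
      (fun c a' h' => by
        simp only [TensorProduct.tmul_smul, mul_smul_comm, map_smul])))
    (fun a₁ a₂ h => by ext; simp [smashTri_add_left])
    (fun c a h => by ext; simp [smashTri_smul_left])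
    (fun a h₁ h₂ => by ext; simp [TensorProduct.tmul_add, mul_add, add_mul])
    (fun c a h => by
      ext
      simp only [map_smul, Algebra.smul_mul_assoc, TensorProduct.tmul_smul, mul_smul_comm,
        TensorProduct.AlgebraTensorModule.curry_apply, LinearMap.restrictScalars_self,
        TensorProduct.curry_apply, TensorProduct.lift.tmul, LinearMap.mk₂_apply,
        LinearMap.smul_apply]))

theorem smashMul_tmul (𝒜 : HModuleData k H A) (a a' : A) (h h' : H) :
    smashMul 𝒜 (a ⊗ₜ[k] h) (a' ⊗ₜ[k] h') =
      smashTri 𝒜 a a' (Φinv k H * (1 ⊗ₜ[k] (Δ k H h * (1 ⊗ₜ[k] h')))) := by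
  simp [smashMul]

/-- The linear map `T ↦ (T¹ · a) [(T² · b) (T³ · c)] ⊗ T⁴`. -/
def smashQuad (𝒜 : HModuleData k H A) (a b c : A) :
    H ⊗[k] (H ⊗[k] (H ⊗[k] H)) →ₗ[k] A ⊗[k] H :=
  (TensorProduct.lift 𝒜.mul).rTensor H ∘ₗ
    (TensorProduct.assoc k A A H).symm.toLinearMap ∘ₗ
    TensorProduct.map (𝒜.act.toLinearMap.flip a) (smashTri 𝒜 b c)

theorem smashQuad_tmul (𝒜 : HModuleData k H A) (a b c : A) (x y z t : H) :
    smashQuad 𝒜 a b c (x ⊗ₜ[k] (y ⊗ₜ[k] (z ⊗ₜ[k] t))) =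
      𝒜.mul (𝒜.act x a) (𝒜.mul (𝒜.act y b) (𝒜.act z c)) ⊗ₜ[k] t := by
  simp [smashQuad, smashTri_tmul]

theorem smash_reassoc {𝒜 : HModuleData k H A} (h𝒜 : 𝒜.IsModuleAlgebra) (a b c : A)
    (x y z t : H) :
    𝒜.mul (𝒜.mul (𝒜.act x a) (𝒜.act y b)) (𝒜.act z c) ⊗ₜ[k] t =
      smashQuad 𝒜 a b c (padRight k H (Φ k H) * (x ⊗ₜ[k] (y ⊗ₜ[k] (z ⊗ₜ[k] t)))) := by
  rw [h𝒜.mul_assoc, associator_tmul]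
  generalize Φ k H = X
  induction X with
  | zero => simp
  | add X Y hX hY =>
    simp only [map_add, LinearMap.add_apply, TensorProduct.add_tmul, add_mul, hX, hY]
  | tmul X₁ X =>
    induction X with
    | zero => simp
    | add X Y hX hY =>
      simp only [TensorProduct.tmul_add, map_add, LinearMap.add_apply, TensorProduct.add_tmul,
        add_mul, hX, hY]
    | tmul X₂ X₃ =>
      simp [tripleAct_tmul, padRight, smashQuad_tmul, HModuleData.μ]

theorem smash_assoc_left_aux {𝒜 : HModuleData k H A} (h𝒜 : 𝒜.IsModuleAlgebra) (a b c : A)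
    (p q : H) (V : H ⊗[k] (H ⊗[k] H)) (W : H ⊗[k] H) :
    smashTri 𝒜 (𝒜.mul (𝒜.act p a) (𝒜.act q b)) c (V * (1 ⊗ₜ[k] W)) =
      smashQuad 𝒜 a b c (padRight k H (Φ k H) * slot1 (Δ k H) V * (p ⊗ₜ[k] (q ⊗ₜ[k] W))) := by
  induction V with
  | zero => simp
  | add X Y hX hY => simp only [add_mul, mul_add, map_add, hX, hY]
  | tmul v₁ V =>
    induction V with
    | zero => simp
    | add X Y hX hY => simp only [TensorProduct.tmul_add, add_mul, mul_add, map_add, hX, hY]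
    | tmul v₂ v₃ =>
      induction W with
      | zero => simp
      | add X Y hX hY => simp only [TensorProduct.tmul_add, mul_add, map_add, hX, hY]
      | tmul w₁ w₂ =>
        rw [Algebra.TensorProduct.tmul_mul_tmul, Algebra.TensorProduct.tmul_mul_tmul,
          smashTri_tmul, mul_one, h𝒜.act_mul, tensorAct_apply]
        have hslot : slot1 (Δ k H) (v₁ ⊗ₜ[k] (v₂ ⊗ₜ[k] v₃)) =
            Algebra.TensorProduct.assoc k k k H H (H ⊗[k] H)
              (Δ k H v₁ ⊗ₜ[k] (v₂ ⊗ₜ[k] v₃)) := rfl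
        rw [hslot]
        generalize Δ k H v₁ = D
        induction D with
        | zero => simp
        | add X Y hX hY =>
          simp only [TensorProduct.add_tmul, add_mul, mul_add, map_add, LinearMap.add_apply, hX, hY]
        | tmul d₁ d₂ =>
          have h := smash_reassoc h𝒜 a b c (d₁ * p) (d₂ * q) (v₂ * w₁) (v₃ * w₂)
          rw [mul_assoc, Algebra.TensorProduct.assoc_tmul]
          simp only [Algebra.TensorProduct.tmul_mul_tmul]
          rw [← h]
          simp [HModuleData.μ, Module.endTensorEndAlgHom_apply]

theorem smash_assoc_left {𝒜 : HModuleData k H A} (h𝒜 : 𝒜.IsModuleAlgebra) (a b c : A) (t : H)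
    (T : H ⊗[k] (H ⊗[k] H)) :
    smashMul 𝒜 (smashTri 𝒜 a b T) (c ⊗ₜ[k] t) =
      smashQuad 𝒜 a b c (padRight k H (Φ k H) * slot1 (Δ k H) (Φinv k H) *
        (slot3 (Δ k H) T * (1 ⊗ₜ[k] (1 ⊗ₜ[k] (1 ⊗ₜ[k] t))))) := by
  induction T with
  | zero => simp
  | add X Y hX hY => simp only [map_add, LinearMap.add_apply, add_mul, mul_add, hX, hY]
  | tmul p T =>
    induction T with
    | zero => simp
    | add X Y hX hY =>
      simp only [TensorProduct.tmul_add, map_add, LinearMap.add_apply, add_mul, mul_add, hX, hY]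
    | tmul q r =>
      rw [smashTri_tmul, smashMul_tmul, smash_assoc_left_aux h𝒜]
      simp [slot3, tensorRight]

theorem smash_assoc_right_aux {𝒜 : HModuleData k H A} (h𝒜 : 𝒜.IsModuleAlgebra) (a b c : A)
    (p q r : H) (V : H ⊗[k] (H ⊗[k] H)) :
    smashTri 𝒜 a (𝒜.mul (𝒜.act p b) (𝒜.act q c)) (V * (1 ⊗ₜ[k] (1 ⊗ₜ[k] r))) =
      smashQuad 𝒜 a b c (slot2 (Δ k H) V * (1 ⊗ₜ[k] (p ⊗ₜ[k] (q ⊗ₜ[k] r)))) := by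
  induction V with
  | zero => simp
  | add X Y hX hY => simp only [add_mul, mul_add, map_add, hX, hY]
  | tmul v₁ V =>
    induction V with
    | zero => simp
    | add X Y hX hY => simp only [TensorProduct.tmul_add, add_mul, mul_add, map_add, hX, hY]
    | tmul v₂ v₃ =>
      rw [Algebra.TensorProduct.tmul_mul_tmul, Algebra.TensorProduct.tmul_mul_tmul,
        smashTri_tmul, mul_one, mul_one, h𝒜.act_mul, tensorAct_apply]
      have hslot : slot2 (Δ k H) (v₁ ⊗ₜ[k] (v₂ ⊗ₜ[k] v₃)) =
          v₁ ⊗ₜ[k] Algebra.TensorProduct.assoc k k k H H H (Δ k H v₂ ⊗ₜ[k] v₃) := rfl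
      rw [hslot]
      generalize Δ k H v₂ = D
      induction D with
      | zero => simp
      | add X Y hX hY =>
        simp only [TensorProduct.add_tmul, TensorProduct.tmul_add, add_mul, mul_add, map_add,
          LinearMap.add_apply, hX, hY]
      | tmul d₁ d₂ =>
        simp [HModuleData.μ, Module.endTensorEndAlgHom_apply, smashQuad_tmul]

theorem smash_assoc_right {𝒜 : HModuleData k H A} (h𝒜 : 𝒜.IsModuleAlgebra) (a b c : A) (h : H)
    (T : H ⊗[k] (H ⊗[k] H)) :
    smashMul 𝒜 (a ⊗ₜ[k] h) (smashTri 𝒜 b c T) =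
      smashQuad 𝒜 a b c (slot2 (Δ k H) (Φinv k H * (1 ⊗ₜ[k] Δ k H h)) * padLeft k H T) := by
  induction T with
  | zero => simp
  | add X Y hX hY => simp only [map_add, mul_add, hX, hY]
  | tmul p T =>
    induction T with
    | zero => simp
    | add X Y hX hY => simp only [TensorProduct.tmul_add, map_add, mul_add, hX, hY]
    | tmul q r =>
      rw [smashTri_tmul, smashMul_tmul]
      have := smash_assoc_right_aux h𝒜 a b c p q r (Φinv k H * (1 ⊗ₜ[k] Δ k H h))
      simp only [padLeft, Algebra.TensorProduct.includeRight_apply]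
      rw [← this, mul_assoc, Algebra.TensorProduct.tmul_mul_tmul, mul_one]

/-- `(Φ ⊗ 1)(Δ ⊗ id ⊗ id)(Φ⁻¹)(id ⊗ id ⊗ Δ)(Φ⁻¹) = (id ⊗ Δ ⊗ id)(Φ⁻¹)(1 ⊗ Φ⁻¹)` -/
theorem pentagon_inv :
    padRight k H (Φ k H) * slot1 (Δ k H) (Φinv k H) * slot3 (Δ k H) (Φinv k H) =
      slot2 (Δ k H) (Φinv k H) * padLeft k H (Φinv k H) := by
  have inv (F : H ⊗[k] (H ⊗[k] H) →ₐ[k] H ⊗[k] (H ⊗[k] (H ⊗[k] H))) :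
      F (Φ k H) * F (Φinv k H) = 1 ∧ F (Φinv k H) * F (Φ k H) = 1 := by
    simp [← map_mul]
  have hp := QuasiBialgebra.pentagon (k := k) (H := H)
  obtain ⟨h1, h1'⟩ := inv (slot1 (Δ k H))
  obtain ⟨h2, h2'⟩ := inv (slot2 (Δ k H))
  obtain ⟨h3, h3'⟩ := inv (slot3 (Δ k H))
  obtain ⟨h4, h4'⟩ := inv (padLeft k H)
  have e : padRight k H (Φ k H) = slot2 (Δ k H) (Φinv k H) * padLeft k H (Φinv k H) *
      (slot3 (Δ k H) (Φ k H) * slot1 (Δ k H) (Φ k H)) := by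
    rw [← hp]
    simp only [← mul_assoc]
    rw [mul_assoc (slot2 (Δ k H) (Φinv k H)), h4', mul_one, h2', one_mul]
  rw [e, mul_assoc _ _ (slot1 (Δ k H) (Φinv k H)), mul_assoc _ (slot1 (Δ k H) (Φ k H)), h1,
    mul_one, mul_assoc _ (slot3 (Δ k H) (Φ k H)), h3, mul_one]

theorem smashMul_assoc {𝒜 : HModuleData k H A} (h𝒜 : 𝒜.IsModuleAlgebra) (s t r : A ⊗[k] H) :
    smashMul 𝒜 (smashMul 𝒜 s t) r = smashMul 𝒜 s (smashMul 𝒜 t r) := by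
  induction s with
  | zero => simp
  | add X Y hX hY => simp only [map_add, LinearMap.add_apply, hX, hY]
  | tmul a h =>
  induction t with
  | zero => simp
  | add X Y hX hY => simp only [map_add, LinearMap.add_apply, hX, hY]
  | tmul b h' =>
  induction r with
  | zero => simp
  | add X Y hX hY => simp only [map_add, hX, hY]
  | tmul c h'' =>
  rw [smashMul_tmul, smashMul_tmul, smash_assoc_left h𝒜, smash_assoc_right h𝒜]
  congr 1
  have hco : Φinv k H * tensorRight (Δ k H) (Δ k H h) =
      tensorLeft (Δ k H) (Δ k H h) * Φinv k H := by
    rw [QuasiBialgebra.quasi_coassoc h]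
    simp [← mul_assoc]
  have e2 : slot2 (Δ k H) ((1 : H) ⊗ₜ[k] Δ k H h) =
      padLeft k H (tensorLeft (Δ k H) (Δ k H h)) := by
    simp [slot2, padLeft]
  have e3 : slot3 (Δ k H) ((1 : H) ⊗ₜ[k] (Δ k H h * (1 ⊗ₜ[k] h'))) =
      padLeft k H (tensorRight (Δ k H) (Δ k H h)) * padLeft k H (1 ⊗ₜ[k] Δ k H h') := by
    rw [← map_mul]
    simp [slot3, padLeft, tensorRight]
  have e4 : padLeft k H ((1 : H) ⊗ₜ[k] (Δ k H h' * (1 ⊗ₜ[k] h''))) =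
      padLeft k H (1 ⊗ₜ[k] Δ k H h') * ((1 : H) ⊗ₜ[k] (1 ⊗ₜ[k] (1 ⊗ₜ[k] h''))) := by
    simp [padLeft]
  rw [map_mul, map_mul, map_mul, e2, e3, e4]
  simp only [← mul_assoc]
  rw [pentagon_inv]
  congr 2
  rw [mul_assoc (slot2 _ _), ← map_mul, hco, map_mul, ← mul_assoc]

theorem smashTri_one_left {𝒜 : HModuleData k H A} (h𝒜 : 𝒜.IsModuleAlgebra) (a : A)
    (T : H ⊗[k] (H ⊗[k] H)) :
    smashTri 𝒜 𝒜.one a T =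
      TensorProduct.map (𝒜.act.toLinearMap.flip a) LinearMap.id (TensorProduct.lid k (H ⊗[k] H)
        (Algebra.TensorProduct.map (ε k H) (AlgHom.id k (H ⊗[k] H)) T)) := by
  induction T with
  | zero => simp
  | add X Y hX hY => simp only [map_add, hX, hY]
  | tmul x T =>
    induction T with
    | zero => simp
    | add X Y hX hY => simp only [TensorProduct.tmul_add, map_add, hX, hY]
    | tmul y z =>
      simp [smashTri_tmul, h𝒜.act_one, h𝒜.one_mul, TensorProduct.smul_tmul']

theorem smashTri_one_right {𝒜 : HModuleData k H A} (h𝒜 : 𝒜.IsModuleAlgebra) (a : A)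
    (T : H ⊗[k] (H ⊗[k] H)) :
    smashTri 𝒜 a 𝒜.one T =
      TensorProduct.map (𝒜.act.toLinearMap.flip a) (TensorProduct.lid k H).toLinearMap
        (Algebra.TensorProduct.map (AlgHom.id k H)
          (Algebra.TensorProduct.map (ε k H) (AlgHom.id k H)) T) := by
  induction T with
  | zero => simp
  | add X Y hX hY => simp only [map_add, hX, hY]
  | tmul x T =>
    induction T with
    | zero => simp
    | add X Y hX hY => simp only [TensorProduct.tmul_add, map_add, hX, hY]
    | tmul y z =>
      simp [smashTri_tmul, h𝒜.act_one, h𝒜.mul_one, TensorProduct.smul_tmul]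

theorem map_Φinv_eq_one {P : Type*} [Ring P] [Algebra k P]
    (F : H ⊗[k] (H ⊗[k] H) →ₐ[k] P) (hF : F (Φ k H) = 1) : F (Φinv k H) = 1 := by
  have h : F (Φ k H) * F (Φinv k H) = 1 := by
    rw [← map_mul, Units.mul_inv, map_one]
  rwa [hF, one_mul] at h

theorem smash_one_mul {𝒜 : HModuleData k H A} (h𝒜 : 𝒜.IsModuleAlgebra) (s : A ⊗[k] H) :
    smashMul 𝒜 (𝒜.one ⊗ₜ[k] 1) s = s := by
  induction s with
  | zero => simp
  | add X Y hX hY => simp only [map_add, hX, hY]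
  | tmul a h =>
    rw [smashMul_tmul, smashTri_one_left h𝒜, map_mul,
      map_Φinv_eq_one _ QuasiBialgebra.reassociator_counit₁, one_mul, map_one, one_mul]
    simp

theorem smash_mul_one {𝒜 : HModuleData k H A} (h𝒜 : 𝒜.IsModuleAlgebra) (s : A ⊗[k] H) :
    smashMul 𝒜 s (𝒜.one ⊗ₜ[k] 1) = s := by
  induction s with
  | zero => simp
  | add X Y hX hY => simp only [map_add, LinearMap.add_apply, hX, hY]
  | tmul a h =>
    rw [smashMul_tmul, smashTri_one_right h𝒜, map_mul,
      map_Φinv_eq_one _ QuasiBialgebra.reassociator_counit₂, one_mul,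
      ← Algebra.TensorProduct.one_def, mul_one, Algebra.TensorProduct.map_tmul,
      QuasiBialgebra.counit_left]
    simp

/-- The smash product `A # H` of a left `H`-module algebra with `H`; as a vector space it is
`A ⊗ H`. -/
def SmashProduct {𝒜 : HModuleData k H A} (_ : 𝒜.IsModuleAlgebra) : Type _ := A ⊗[k] H

variable {𝒜 : HModuleData k H A} (h𝒜 : 𝒜.IsModuleAlgebra)

instance : AddCommGroup (SmashProduct h𝒜) := inferInstanceAs (AddCommGroup (A ⊗[k] H))

instance : Module k (SmashProduct h𝒜) := inferInstanceAs (Module k (A ⊗[k] H))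

/-- The identity map `A ⊗ H → A # H`, `a ⊗ h ↦ a # h`. -/
def toSmash : A ⊗[k] H ≃ₗ[k] SmashProduct h𝒜 := LinearEquiv.refl k (A ⊗[k] H)

/-- `A # H` is an associative unital ring with the smash product multiplication and unit
`1 # 1`. -/
instance : Ring (SmashProduct h𝒜) :=
  { (inferInstance : AddCommGroup (SmashProduct h𝒜)) with
    mul := fun s t => toSmash h𝒜 (smashMul 𝒜 ((toSmash h𝒜).symm s) ((toSmash h𝒜).symm t))
    one := toSmash h𝒜 (𝒜.one ⊗ₜ[k] 1)
    mul_assoc := fun s t r => smashMul_assoc h𝒜 s t r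
    one_mul := fun s => smash_one_mul h𝒜 s
    mul_one := fun s => smash_mul_one h𝒜 s
    left_distrib := fun s t r => map_add (smashMul 𝒜 s) t r
    right_distrib := fun s t r => LinearMap.map_add₂ (smashMul 𝒜) s t r
    zero_mul := fun s => LinearMap.map_zero₂ (smashMul 𝒜) s
    mul_zero := fun s => map_zero (smashMul 𝒜 s) }

instance : Algebra k (SmashProduct h𝒜) :=
  Algebra.ofModule (fun c s t => LinearMap.map_smul₂ (smashMul 𝒜) c s t)
    (fun c s t => map_smul (smashMul 𝒜 s) c t)

theorem toSmash_mul (s t : A ⊗[k] H) :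
    toSmash h𝒜 s * toSmash h𝒜 t = toSmash h𝒜 (smashMul 𝒜 s t) :=
  rfl

/-- The algebra map `j : H → A # H`, `j(h) = 1 # h`. -/
def smashJ : H →ₐ[k] SmashProduct h𝒜 :=
  AlgHom.ofLinearMap ((toSmash h𝒜).toLinearMap ∘ₗ TensorProduct.mk k A H 𝒜.one) rfl
    (by
      intro x y
      change toSmash h𝒜 (𝒜.one ⊗ₜ[k] (x * y)) =
        toSmash h𝒜 (𝒜.one ⊗ₜ[k] x) * toSmash h𝒜 (𝒜.one ⊗ₜ[k] y)
      rw [toSmash_mul, smashMul_tmul, smashTri_one_left h𝒜, map_mul,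
        map_Φinv_eq_one _ QuasiBialgebra.reassociator_counit₁, one_mul]
      congr 1
      have key : ∀ D : H ⊗[k] H,
          TensorProduct.map (𝒜.act.toLinearMap.flip 𝒜.one) LinearMap.id (D * (1 ⊗ₜ[k] y)) =
            𝒜.one ⊗ₜ[k] (TensorProduct.lid k H
              (Algebra.TensorProduct.map (ε k H) (AlgHom.id k H) D) * y) := by
        intro D
        induction D with
        | zero => simp
        | add X Y hX hY => simp only [add_mul, map_add, TensorProduct.tmul_add, hX, hY]
        | tmul p q => simp [h𝒜.act_one, TensorProduct.smul_tmul]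
      have hk := key (Δ k H x)
      rw [QuasiBialgebra.counit_left] at hk
      simpa using hk.symm)

end Smash

section Pi

variable {k : Type u} {H : Type v} [Field k] [Ring H] [Algebra k H] [QuasiHopfAlgebra k H]
variable {A : Type*} [AddCommGroup A] [Module k A]

/-- `(A # H)^j`, the left `H`-module algebra induced by `j : H → A # H`. -/
def smashInduced {𝒜 : HModuleData k H A} (h𝒜 : 𝒜.IsModuleAlgebra) :
    HModuleData k H (SmashProduct h𝒜) :=
  induced (smashJ h𝒜)

/-- The linear map `a ⊗ h ↦ T¹ · a ⊗ T² h S(T³)`. -/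
def conjMap (𝒜 : HModuleData k H A) (T : H ⊗[k] (H ⊗[k] H)) : A ⊗[k] H →ₗ[k] A ⊗[k] H :=
  Module.endTensorEndAlgHom (S := k)
    (TensorProduct.map 𝒜.act.toLinearMap (sandwich LinearMap.id (S k H)) T)

/-- The map `Π : A ◇ H₀ → (A # H)^j`, `Π(a ⊗ h) = x¹ · a # x² h S(x³)`. -/
def smashPi {𝒜 : HModuleData k H A} (h𝒜 : 𝒜.IsModuleAlgebra) :
    A ⊗[k] H →ₗ[k] SmashProduct h𝒜 :=
  (toSmash h𝒜).toLinearMap ∘ₗ conjMap 𝒜 (Φinv k H)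

theorem conjMap_tmul (𝒜 : HModuleData k H A) (x y z : H) (a : A) (h : H) :
    conjMap 𝒜 (x ⊗ₜ[k] (y ⊗ₜ[k] z)) (a ⊗ₜ[k] h) =
      𝒜.act x a ⊗ₜ[k] (y * h * QuasiHopf.S k H z) := by
  simp [conjMap, sandwich_tmul, Module.endTensorEndAlgHom_apply]

end Pi

end

end QuasiHopf

/-!
For an algebra `B` with an algebra map `v : H → B`, the module `B^v` is the value at `B` of the
right adjoint of the monoidal functor `M ↦ M ⊗ H` from left `H`-modules to `H`-bimodules. So an
`H`-linear map `M → B^v` corresponds to a linear map `γ : M → B` with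
`v(h) γ(m) = γ(h₁ · m) v(h₂)` (`IsEquivariant`). The identity of `B^v` corresponds to
`θ(b) = v(X¹) b v(S(X²) α X³)` (`counitMap`), and each equivariant `γ` gives an `H`-linear map
`M ⊗ B^v → B^v`, `m ⊗ b ↦ γ(x¹ · m) v(x²) b v(S(x³))` (`extend`). By the pentagon, the product `⋆`
is `extend` of `θ` (`inducedMul_eq_extend`), and `extend` turns the product
`γ(X¹ · m) γ'(X² · n) v(X³)` of equivariant maps into a composite
(`IsEquivariant.extend_convMap`). As `θ` of an extension is again such a product
(`IsEquivariant.counitMap_extend`), the product `⋆` is associative, and `B^v` is a left `H`-module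
algebra (`induced_isModuleAlgebra`).

In `C = (A # H)^j`, the equivariant map `a ↦ a # 1` corresponds to a morphism of left `H`-module
algebras `ι : A → C`, the map `j` is a morphism `H₀ → C`, and `Π(a ⊗ h) = ι(a) ⋆ j(h)`
(`smashPi_eq_mulMap`). Since `Π` is bijective, `C` factorizes as `A ⊗ H₀`, and the general facts
`isTwistingMap_of_factorization` and `isModuleAlgebraIso_of_factorization` show that
`Π⁻¹(j(h) ⋆ ι(a))` is a twisting map for which `Π` is an isomorphism of algebras; the axioms for
`A ◇ H₀` are then transported along `Π`.

It remains to see that this twisting map is `R`, i.e. `Π(R(h ⊗ a)) = j(h) ⋆ ι(a)`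
(`smashPi_diamondTwist`). Put `p = x¹ ⊗ x² β S(x³)` and `W = Δ(S(x¹) α x²) p (1 ⊗ S(x³))`. The
pentagon gives `g = Δ(S(p¹)) W (p² ⊗ 1)` (`elemg_eq_conjW`). From this description of `g` follow
both `Δ(S(h)) g = g (S ⊗ S)(Δ^cop(h))` and `g (S(q²) ⊗ S(q¹)) = W`, and these two identities turn
the formula for `R` into the one for `j(h) ⋆ ι(a)`.

Identities between elements of tensor powers of `H` are proved by applying a linear map to a form
of the pentagon. A linear map that contains `S(y) α z`, or `β S(z)`, sees a factor `Δ(h)` there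
only through `ε(h)`; this is expressed by replacing `Δ` with `trivialComul`.
-/

namespace QuasiHopf

noncomputable section

universe u v

/-! ### Tensor induction and consequences of the pentagon -/

section Tensors

/-- Induction on threefold tensors: sums and pure tensors suffice. -/
theorem tensor_induction₃ {k M N L : Type*} [CommSemiring k] [AddCommMonoid M] [Module k M]
    [AddCommMonoid N] [Module k N] [AddCommMonoid L] [Module k L]
    {p : M ⊗[k] (N ⊗[k] L) → Prop} (add : ∀ X Y, p X → p Y → p (X + Y))
    (tmul : ∀ x y z, p (x ⊗ₜ[k] (y ⊗ₜ[k] z))) (T : M ⊗[k] (N ⊗[k] L)) : p T := by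
  induction T with
  | zero => simpa using tmul 0 0 0
  | add X Y hX hY => exact add X Y hX hY
  | tmul x T =>
    induction T with
    | zero => simpa using tmul 0 0 0
    | add X Y hX hY => rw [TensorProduct.tmul_add]; exact add _ _ hX hY
    | tmul y z => exact tmul x y z

/-- Induction on fourfold tensors: sums and pure tensors suffice. -/
theorem tensor_induction₄ {k M N L K : Type*} [CommSemiring k] [AddCommMonoid M] [Module k M]
    [AddCommMonoid N] [Module k N] [AddCommMonoid L] [Module k L] [AddCommMonoid K] [Module k K]
    {p : M ⊗[k] (N ⊗[k] (L ⊗[k] K)) → Prop} (add : ∀ X Y, p X → p Y → p (X + Y))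
    (tmul : ∀ x y z t, p (x ⊗ₜ[k] (y ⊗ₜ[k] (z ⊗ₜ[k] t)))) (T : M ⊗[k] (N ⊗[k] (L ⊗[k] K))) :
    p T := by
  induction T using tensor_induction₃ with
  | add X Y hX hY => exact add X Y hX hY
  | tmul x y T =>
    induction T with
    | zero => simpa using tmul 0 0 0 0
    | add X Y hX hY => simp only [TensorProduct.tmul_add]; exact add _ _ hX hY
    | tmul z t => exact tmul x y z t

variable {k : Type u} {H : Type v} [Field k] [Ring H] [Algebra k H]

theorem slot1_tmul (D : H →ₐ[k] H ⊗[k] H) (x y z : H) :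
    slot1 D (x ⊗ₜ[k] (y ⊗ₜ[k] z)) = TensorProduct.assoc k H H (H ⊗[k] H) (D x ⊗ₜ (y ⊗ₜ z)) := rfl

theorem slot2_tmul (D : H →ₐ[k] H ⊗[k] H) (x y z : H) :
    slot2 D (x ⊗ₜ[k] (y ⊗ₜ[k] z)) = x ⊗ₜ TensorProduct.assoc k H H H (D y ⊗ₜ z) := rfl

theorem slot3_tmul (D : H →ₐ[k] H ⊗[k] H) (x y z : H) :
    slot3 D (x ⊗ₜ[k] (y ⊗ₜ[k] z)) = x ⊗ₜ (y ⊗ₜ D z) := rfl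

theorem padLeft_apply (T : H ⊗[k] (H ⊗[k] H)) : padLeft k H T = 1 ⊗ₜ T := rfl

theorem padRight_tmul (x y z : H) :
    padRight k H (x ⊗ₜ[k] (y ⊗ₜ[k] z)) = x ⊗ₜ (y ⊗ₜ (z ⊗ₜ 1)) := rfl

theorem tensorLeft_tmul (D : H →ₐ[k] H ⊗[k] H) (x y : H) :
    tensorLeft D (x ⊗ₜ[k] y) = TensorProduct.assoc k H H H (D x ⊗ₜ y) := rfl

theorem tensorRight_tmul (D : H →ₐ[k] H ⊗[k] H) (x y : H) :
    tensorRight D (x ⊗ₜ[k] y) = x ⊗ₜ D y := rfl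

end Tensors

section Reassociator

variable (k : Type u) (H : Type v) [Field k] [Ring H] [Algebra k H] [QuasiBialgebra k H]

/-- The algebra map `h ↦ ε(h) 1 ⊗ 1`. A functional that absorbs a factor `Δ(h)` into `ε(h)` does
not distinguish it from `Δ`, and it sends `Φ` to `1` when applied to any tensor factor. -/
def trivialComul : H →ₐ[k] H ⊗[k] H := (Algebra.ofId k (H ⊗[k] H)).comp (ε k H)

variable {k H}

theorem trivialComul_apply (h : H) : trivialComul k H h = ε k H h • (1 ⊗ₜ 1) := by
  simp [trivialComul, Algebra.ofId_apply, Algebra.algebraMap_eq_smul_one,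
    Algebra.TensorProduct.one_def]

theorem slot1_trivialComul : slot1 (trivialComul k H) (Φ k H) = 1 := by
  have h : ∀ T : H ⊗[k] (H ⊗[k] H), slot1 (trivialComul k H) T =
      slot1 (Algebra.TensorProduct.includeLeft) ((Algebra.TensorProduct.map (Algebra.ofId k H)
        (AlgHom.id k (H ⊗[k] H)))
        (Algebra.TensorProduct.map (ε k H) (AlgHom.id k (H ⊗[k] H)) T)) := by
    intro T
    induction T using tensor_induction₃ with
    | add X Y hX hY => simp only [map_add, hX, hY]
    | tmul x y z =>
      simp [slot1_tmul, trivialComul_apply, Algebra.ofId_apply, Algebra.algebraMap_eq_smul_one,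
        TensorProduct.smul_tmul']
  rw [h, QuasiBialgebra.reassociator_counit₁, map_one, map_one]

theorem slot2_trivialComul : slot2 (trivialComul k H) (Φ k H) = 1 := by
  have h : ∀ T : H ⊗[k] (H ⊗[k] H), slot2 (trivialComul k H) T =
      slot2 (Algebra.TensorProduct.includeLeft) ((Algebra.TensorProduct.map (AlgHom.id k H)
        (Algebra.TensorProduct.map (Algebra.ofId k H) (AlgHom.id k H)))
        (Algebra.TensorProduct.map (AlgHom.id k H)
          (Algebra.TensorProduct.map (ε k H) (AlgHom.id k H)) T)) := by
    intro T
    induction T using tensor_induction₃ with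
    | add X Y hX hY => simp only [map_add, hX, hY]
    | tmul x y z =>
      simp [slot2_tmul, trivialComul_apply, Algebra.ofId_apply, Algebra.algebraMap_eq_smul_one,
        TensorProduct.smul_tmul']
  rw [h, QuasiBialgebra.reassociator_counit₂, map_one, map_one]

theorem slot3_trivialComul : slot3 (trivialComul k H) (Φ k H) = 1 := by
  have h : ∀ T : H ⊗[k] (H ⊗[k] H), slot3 (trivialComul k H) T =
      slot3 (Algebra.TensorProduct.includeLeft) ((Algebra.TensorProduct.map (AlgHom.id k H)
        (Algebra.TensorProduct.map (AlgHom.id k H) (Algebra.ofId k H)))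
        (Algebra.TensorProduct.map (AlgHom.id k H)
          (Algebra.TensorProduct.map (AlgHom.id k H) (ε k H)) T)) := by
    intro T
    induction T using tensor_induction₃ with
    | add X Y hX hY => simp only [map_add, hX, hY]
    | tmul x y z =>
      simp [slot3_tmul, trivialComul_apply, Algebra.ofId_apply, Algebra.algebraMap_eq_smul_one,
        TensorProduct.smul_tmul']
      rw [← TensorProduct.smul_tmul', ← TensorProduct.smul_tmul']
      simp only [TensorProduct.tmul_smul]
  rw [h, QuasiBialgebra.reassociator_counit₃, map_one, map_one]

theorem map_Φ_mul_map_Φinv (F : H ⊗[k] (H ⊗[k] H) →ₐ[k] H ⊗[k] (H ⊗[k] (H ⊗[k] H))) :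
    F (Φ k H) * F (Φinv k H) = 1 := by
  rw [← map_mul, Units.mul_inv, map_one]

theorem map_Φinv_mul_map_Φ (F : H ⊗[k] (H ⊗[k] H) →ₐ[k] H ⊗[k] (H ⊗[k] (H ⊗[k] H))) :
    F (Φinv k H) * F (Φ k H) = 1 := by
  rw [← map_mul, Units.inv_mul, map_one]

theorem slot2_trivialComul_inv : slot2 (trivialComul k H) (Φinv k H) = 1 := by
  rw [← one_mul (slot2 (trivialComul k H) (Φinv k H)), ← slot2_trivialComul,
    map_Φ_mul_map_Φinv, slot2_trivialComul]

theorem slot3_trivialComul_inv : slot3 (trivialComul k H) (Φinv k H) = 1 := by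
  rw [← one_mul (slot3 (trivialComul k H) (Φinv k H)), ← slot3_trivialComul,
    map_Φ_mul_map_Φinv, slot3_trivialComul]

/-- `(Φ ⊗ 1)(Δ ⊗ id ⊗ id)(Φ⁻¹) = (id ⊗ Δ ⊗ id)(Φ⁻¹)(1 ⊗ Φ⁻¹)(id ⊗ id ⊗ Δ)(Φ)` -/
theorem padRight_mul_slot1 :
    padRight k H (Φ k H) * slot1 (Δ k H) (Φinv k H) =
      slot2 (Δ k H) (Φinv k H) * padLeft k H (Φinv k H) * slot3 (Δ k H) (Φ k H) := by
  rw [← pentagon_inv, mul_assoc _ (slot3 _ _), map_Φinv_mul_map_Φ, mul_one]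

/-- `(Δ ⊗ id ⊗ id)(Φ)(Φ⁻¹ ⊗ 1) = (id ⊗ id ⊗ Δ)(Φ⁻¹)(1 ⊗ Φ)(id ⊗ Δ ⊗ id)(Φ)` -/
theorem slot1_mul_padRight :
    slot1 (Δ k H) (Φ k H) * padRight k H (Φinv k H) =
      slot3 (Δ k H) (Φinv k H) * padLeft k H (Φ k H) * slot2 (Δ k H) (Φ k H) := by
  have h : slot3 (Δ k H) (Φinv k H) * (padLeft k H (Φ k H) * slot2 (Δ k H) (Φ k H) *
      padRight k H (Φ k H)) = slot1 (Δ k H) (Φ k H) := by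
    rw [QuasiBialgebra.pentagon]
    change _ * (slot3 (Δ k H) (Φ k H) * slot1 (Δ k H) (Φ k H)) = _
    rw [← mul_assoc, map_Φinv_mul_map_Φ, one_mul]
  rw [← h]
  simp only [mul_assoc]
  rw [map_Φ_mul_map_Φinv, mul_one]

/-- `(id ⊗ id ⊗ Δ)(Φ⁻¹)(1 ⊗ Φ) = (Δ ⊗ id ⊗ id)(Φ)(Φ⁻¹ ⊗ 1)(id ⊗ Δ ⊗ id)(Φ⁻¹)` -/
theorem slot3_mul_padLeft :
    slot3 (Δ k H) (Φinv k H) * padLeft k H (Φ k H) =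
      slot1 (Δ k H) (Φ k H) * padRight k H (Φinv k H) * slot2 (Δ k H) (Φinv k H) := by
  rw [slot1_mul_padRight, mul_assoc _ (slot2 _ _), map_Φ_mul_map_Φinv, mul_one]

theorem Φ_mul_tensorLeft (h : H) :
    Φ k H * tensorLeft (Δ k H) (Δ k H h) = tensorRight (Δ k H) (Δ k H h) * Φ k H := by
  rw [QuasiBialgebra.quasi_coassoc h]
  simp [mul_assoc]

theorem Φinv_mul_tensorRight (h : H) :
    Φinv k H * tensorRight (Δ k H) (Δ k H h) = tensorLeft (Δ k H) (Δ k H h) * Φinv k H := by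
  rw [QuasiBialgebra.quasi_coassoc h]
  simp [← mul_assoc]

end Reassociator

/-! ### The adjunction between `M ↦ M ⊗ H` and `B ↦ B^v` -/

section Adjunction

variable {k : Type u} {H : Type v} [Field k] [Ring H] [Algebra k H] [QuasiHopfAlgebra k H]
variable {B : Type*} [Ring B] [Algebra k B]
variable {M N : Type*} [AddCommGroup M] [Module k M] [AddCommGroup N] [Module k N]

/-- The action `(x ⊗ y) · b = v(x) b v(S(y))` of `H ⊗ H` on `B`. -/
def biAct (v : H →ₐ[k] B) : H ⊗[k] H →ₐ[k] Module.End k B :=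
  AlgHom.ofLinearMap (sandwich v.toLinearMap (v.toLinearMap ∘ₗ S k H))
    (by
      ext b
      simp [Algebra.TensorProduct.one_def, sandwich_tmul, QuasiHopfAlgebra.antipode_one])
    (by
      intro s t
      induction s with
      | zero => simp
      | add x y hx hy => simp only [add_mul, map_add, hx, hy]
      | tmul x y =>
        induction t with
        | zero => simp
        | add x y hx hy => simp only [mul_add, map_add, hx, hy]
        | tmul x' y' =>
          ext b
          simp [sandwich_tmul, QuasiHopfAlgebra.antipode_mul, mul_assoc])

theorem biAct_tmul (v : H →ₐ[k] B) (x y : H) (b : B) :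
    biAct v (x ⊗ₜ[k] y) b = v x * b * v (S k H y) := by
  simp [biAct, sandwich_tmul]

theorem inducedAct_apply (v : H →ₐ[k] B) (h : H) : inducedAct v h = biAct v (Δ k H h) := rfl

/-- `h₁ β S(h₂) = ε(h) β` in `B`. -/
theorem inducedAct_β (v : H →ₐ[k] B) (h : H) :
    biAct v (Δ k H h) (v (β k H)) = ε k H h • v (β k H) := by
  have key : ∀ D : H ⊗[k] H, biAct v D (v (β k H)) =
      v (sandwich LinearMap.id (S k H) D (β k H)) := by
    intro D
    induction D with
    | zero => simp
    | add X Y hX hY => simp only [map_add, LinearMap.add_apply, hX, hY]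
    | tmul x y => simp [biAct_tmul, sandwich_tmul]
  rw [key, QuasiHopfAlgebra.antipode_right, map_smul]

theorem antiα_tmul (x y : H) : antiα k H (x ⊗ₜ[k] y) = S k H x * α k H * y := by
  simp [antiα, prod2_tmul]

theorem antiα_comul (h : H) : antiα k H (Δ k H h) = ε k H h • α k H := by
  rw [← QuasiHopfAlgebra.antipode_left]
  generalize Δ k H h = D
  induction D with
  | zero => simp
  | add X Y hX hY => simp only [map_add, LinearMap.add_apply, hX, hY]
  | tmul x y => simp [antiα_tmul, sandwich_tmul]

theorem antiα_tmul_mul (x y : H) (D : H ⊗[k] H) :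
    antiα k H (D * (x ⊗ₜ[k] y)) = S k H x * antiα k H D * y := by
  induction D with
  | zero => simp
  | add X Y hX hY => simp only [add_mul, mul_add, map_add, hX, hY]
  | tmul x' y' => simp [antiα_tmul, QuasiHopfAlgebra.antipode_mul, mul_assoc]

/-- `S(h₁ x) α h₂ y = ε(h) S(x) α y` -/
theorem antiα_comul_mul (h : H) (D : H ⊗[k] H) :
    antiα k H (Δ k H h * D) = ε k H h • antiα k H D := by
  induction D with
  | zero => simp
  | add X Y hX hY => simp only [mul_add, map_add, smul_add, hX, hY]
  | tmul x y => rw [antiα_tmul_mul, antiα_comul, antiα_tmul]; simp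

/-- The action `(x ⊗ T) · (m ⊗ b) = x · m ⊗ T · b` of `H ⊗ (H ⊗ H)` on `M ⊗ B`. -/
def twoAct (ρ : H →ₐ[k] Module.End k M) (v : H →ₐ[k] B) :
    H ⊗[k] (H ⊗[k] H) →ₐ[k] Module.End k (M ⊗[k] B) :=
  Module.endTensorEndAlgHom.comp (Algebra.TensorProduct.map ρ (biAct v))

theorem twoAct_tmul (ρ : H →ₐ[k] Module.End k M) (v : H →ₐ[k] B) (x : H) (T : H ⊗[k] H) (m : M)
    (b : B) : twoAct ρ v (x ⊗ₜ[k] T) (m ⊗ₜ[k] b) = ρ x m ⊗ₜ[k] biAct v T b := rfl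

theorem tensorAct_induced (ρ : H →ₐ[k] Module.End k M) (v : H →ₐ[k] B) (h : H) :
    tensorAct ρ (inducedAct v) h = twoAct ρ v (tensorRight (Δ k H) (Δ k H h)) := by
  rw [tensorAct_apply]
  generalize Δ k H h = D
  induction D with
  | zero => simp
  | add X Y hX hY => simp only [map_add, hX, hY]
  | tmul x y => rfl

/-- A linear map `γ : M → B` such that `v(h) γ(m) = γ(h₁ · m) v(h₂)`. Such maps correspond to
bimodule maps `M ⊗ H → B`, `m ⊗ h ↦ γ(m) v(h)`, and to `H`-linear maps `M → B^v`. -/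
def IsEquivariant (ρ : H →ₐ[k] Module.End k M) (v : H →ₐ[k] B) (γ : M →ₗ[k] B) : Prop :=
  ∀ (h : H) (m : M),
    v h * γ m = prod2 (γ ∘ₗ ρ.toLinearMap.flip m) v.toLinearMap (Δ k H h)

/-- The map `m ⊗ b ↦ γ(x¹ · m) v(x²) b v(S(x³))`. -/
def extend (ρ : H →ₐ[k] Module.End k M) (v : H →ₐ[k] B) (γ : M →ₗ[k] B) : M ⊗[k] B →ₗ[k] B :=
  prod2 γ LinearMap.id ∘ₗ twoAct ρ v (Φinv k H)

variable {ρ : H →ₐ[k] Module.End k M} {σ : H →ₐ[k] Module.End k N} {v : H →ₐ[k] B}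
  {γ : M →ₗ[k] B} {γ' : N →ₗ[k] B}

/-- `v(x) (γ(m) b) v(S(y)) = γ(x₁ · m) (v(x₂) b v(S(y)))` -/
theorem IsEquivariant.biAct_prod2 (hγ : IsEquivariant ρ v γ) (D : H ⊗[k] H) (s : M ⊗[k] B) :
    biAct v D (prod2 γ LinearMap.id s) =
      prod2 γ LinearMap.id (twoAct ρ v (tensorLeft (Δ k H) D) s) := by
  induction s with
  | zero => simp
  | add X Y hX hY => simp only [map_add, hX, hY]
  | tmul m b =>
  induction D with
  | zero => simp
  | add X Y hX hY => simp only [map_add, LinearMap.add_apply, hX, hY]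
  | tmul x y =>
  rw [prod2_tmul, biAct_tmul, tensorLeft_tmul, ← mul_assoc, hγ x m]
  generalize Δ k H x = D
  induction D with
  | zero => simp
  | add X Y hX hY =>
    simp only [map_add, add_mul, TensorProduct.add_tmul, LinearMap.add_apply, hX, hY]
  | tmul p q => simp [prod2_tmul, twoAct_tmul, biAct_tmul, mul_assoc]

/-- If `γ` is equivariant, then `extend ρ v γ : M ⊗ B^v → B^v` is `H`-linear. -/
theorem IsEquivariant.extend_act (hγ : IsEquivariant ρ v γ) (h : H) (s : M ⊗[k] B) :
    inducedAct v h (extend ρ v γ s) = extend ρ v γ (tensorAct ρ (inducedAct v) h s) := by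
  simp only [extend, LinearMap.comp_apply]
  rw [inducedAct_apply, hγ.biAct_prod2, tensorAct_induced, ← Module.End.mul_apply,
    ← Module.End.mul_apply, ← map_mul, ← map_mul, Φinv_mul_tensorRight]

/-- The operator `b ↦ v(T¹) b v(S(T²) α T³)` on `B`. -/
def evalAct (v : H →ₐ[k] B) : H ⊗[k] (H ⊗[k] H) →ₗ[k] Module.End k B :=
  sandwich v.toLinearMap (v.toLinearMap ∘ₗ antiα k H)

theorem evalAct_tmul (v : H →ₐ[k] B) (x : H) (D : H ⊗[k] H) (b : B) :
    evalAct v (x ⊗ₜ[k] D) b = v x * b * v (antiα k H D) := by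
  simp [evalAct, sandwich_tmul]

/-- The map `θ(b) = v(X¹) b v(S(X²) α X³)`, the equivariant map that corresponds to the identity
of `B^v`. -/
def counitMap (v : H →ₐ[k] B) : B →ₗ[k] B := evalAct v (Φ k H)

theorem evalAct_mul_pure (v : H →ₐ[k] B) (T : H ⊗[k] (H ⊗[k] H)) (D : H ⊗[k] H) (z : H) (b : B) :
    evalAct v (T * TensorProduct.assoc k H H H (D ⊗ₜ[k] z)) b =
      evalAct v T (biAct v D b) * v z := by
  induction D with
  | zero => simp
  | add X Y hX hY =>
    simp only [map_add, mul_add, add_mul, TensorProduct.add_tmul, LinearMap.add_apply, hX, hY]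
  | tmul p q =>
  induction T using tensor_induction₃ with
  | add X Y hX hY => simp only [map_add, add_mul, LinearMap.add_apply, hX, hY]
  | tmul x y t =>
    simp [evalAct_tmul, antiα_tmul, biAct_tmul, QuasiHopfAlgebra.antipode_mul, mul_assoc]

/-- `v(h) θ(b) = θ(h₁ ▷ b) v(h₂)` -/
theorem counitMap_isEquivariant (v : H →ₐ[k] B) :
    IsEquivariant (inducedAct v) v (counitMap v) := by
  intro h b
  have h1 : ∀ D : H ⊗[k] H, prod2 (counitMap v ∘ₗ (inducedAct v).toLinearMap.flip b)
      v.toLinearMap D = evalAct v (Φ k H * tensorLeft (Δ k H) D) b := by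
    intro D
    induction D with
    | zero => simp
    | add X Y hX hY => simp only [map_add, mul_add, LinearMap.add_apply, hX, hY]
    | tmul x y =>
      rw [tensorLeft_tmul, evalAct_mul_pure, prod2_tmul]
      rfl
  have h2 : ∀ (D : H ⊗[k] H) (T : H ⊗[k] (H ⊗[k] H)),
      evalAct v (tensorRight (Δ k H) D * T) b =
        v (TensorProduct.rid k H (Algebra.TensorProduct.map (AlgHom.id k H) (ε k H) D)) *
          evalAct v T b := by
    intro D T
    induction D with
    | zero => simp
    | add X Y hX hY => simp only [map_add, add_mul, LinearMap.add_apply, hX, hY]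
    | tmul x y =>
    induction T using tensor_induction₃ with
    | add X Y hX hY => simp only [map_add, mul_add, LinearMap.add_apply, hX, hY]
    | tmul p q r =>
      rw [tensorRight_tmul, Algebra.TensorProduct.tmul_mul_tmul, evalAct_tmul, antiα_comul_mul]
      simp [evalAct_tmul, mul_assoc]
  rw [h1, Φ_mul_tensorLeft, h2, QuasiBialgebra.counit_right]
  simp [counitMap]

end Adjunction

/-! ### The module algebra `B^v` -/

section Product

variable {k : Type u} {H : Type v} [Field k] [Ring H] [Algebra k H] [QuasiHopfAlgebra k H]
variable {B : Type*} [Ring B] [Algebra k B]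
variable {M N : Type*} [AddCommGroup M] [Module k M] [AddCommGroup N] [Module k N]

/-- The functional `T ↦ v(T¹) b v(S(T²) α T³) b' v(S(T⁴))`. -/
def mulForm (v : H →ₐ[k] B) (b b' : B) : H ⊗[k] (H ⊗[k] (H ⊗[k] H)) →ₗ[k] B :=
  prod2 (LinearMap.mulRight k b ∘ₗ v.toLinearMap)
    (prod2 (LinearMap.mulRight k b' ∘ₗ v.toLinearMap ∘ₗ antiα k H) (v.toLinearMap ∘ₗ S k H) ∘ₗ
      (TensorProduct.assoc k H H H).symm.toLinearMap)

theorem mulForm_tmul (v : H →ₐ[k] B) (b b' : B) (x y z t : H) :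
    mulForm v b b' (x ⊗ₜ[k] (y ⊗ₜ[k] (z ⊗ₜ[k] t))) =
      v x * b * (v (antiα k H (y ⊗ₜ[k] z)) * b' * v (S k H t)) := by
  simp [mulForm, prod2_tmul]

theorem inducedMul_eq_mulForm (v : H →ₐ[k] B) (b b' : B) :
    inducedMul v b b' = mulForm v b b' (padLeft k H (Φinv k H) * slot3 (Δ k H) (Φ k H)) := by
  change sandwich v.toLinearMap
      (prod2 (LinearMap.mulRight k b' ∘ₗ v.toLinearMap) v.toLinearMap) (elemΘ k H) b = _
  rw [elemΘ]
  generalize padLeft k H (Φinv k H) * slot3 (Δ k H) (Φ k H) = T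
  induction T using tensor_induction₄ with
  | add X Y hX hY => simp only [map_add, LinearMap.add_apply, hX, hY]
  | tmul x y z t => simp [mulForm_tmul, sandwich_tmul, prod2_tmul]

/-- The element `α` between the second and third tensor factor absorbs `Δ(T²)`. -/
theorem mulForm_slot2_mul (v : H →ₐ[k] B) (b b' : B) (T : H ⊗[k] (H ⊗[k] H))
    (U : H ⊗[k] (H ⊗[k] (H ⊗[k] H))) :
    mulForm v b b' (slot2 (Δ k H) T * U) = mulForm v b b' (slot2 (trivialComul k H) T * U) := by
  induction T using tensor_induction₃ with
  | add X Y hX hY => simp only [map_add, add_mul, hX, hY]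
  | tmul x y z =>
  induction U using tensor_induction₄ with
  | add X Y hX hY => simp only [map_add, mul_add, hX, hY]
  | tmul p q r s =>
  have key : ∀ D : H ⊗[k] H,
      mulForm v b b' ((x ⊗ₜ TensorProduct.assoc k H H H (D ⊗ₜ z)) *
        (p ⊗ₜ[k] (q ⊗ₜ[k] (r ⊗ₜ[k] s)))) =
      v (x * p) * b * (v (antiα k H (D * (q ⊗ₜ[k] r))) * b' * v (S k H (z * s))) := by
    intro D
    induction D with
    | zero => simp
    | add X Y hX hY =>
      simp only [map_add, add_mul, mul_add, TensorProduct.add_tmul, TensorProduct.tmul_add, hX, hY]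
    | tmul d e => simp [mulForm_tmul]
  rw [slot2_tmul, slot2_tmul, key, key, antiα_comul_mul, trivialComul_apply,
    ← Algebra.TensorProduct.one_def, smul_mul_assoc, one_mul]
  simp only [map_smul]

/-- For `b' = β` the product `β S(·)` absorbs `Δ(T³)`. -/
theorem mulForm_mul_slot3 (v : H →ₐ[k] B) (b : B) (T : H ⊗[k] (H ⊗[k] H))
    (U : H ⊗[k] (H ⊗[k] (H ⊗[k] H))) :
    mulForm v b (v (β k H)) (U * slot3 (Δ k H) T) =
      mulForm v b (v (β k H)) (U * slot3 (trivialComul k H) T) := by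
  induction T using tensor_induction₃ with
  | add X Y hX hY => simp only [map_add, mul_add, hX, hY]
  | tmul x y z =>
  induction U using tensor_induction₄ with
  | add X Y hX hY => simp only [map_add, add_mul, hX, hY]
  | tmul p q r s =>
  have key : ∀ D : H ⊗[k] H,
      mulForm v b (v (β k H)) ((p ⊗ₜ[k] (q ⊗ₜ[k] (r ⊗ₜ[k] s))) * (x ⊗ₜ (y ⊗ₜ D))) =
      v (p * x) * b * (v (antiα k H ((q * y) ⊗ₜ[k] r)) * biAct v D (v (β k H)) *
        v (S k H s)) := by
    intro D
    induction D with
    | zero => simp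
    | add X Y hX hY =>
      simp only [map_add, add_mul, mul_add, TensorProduct.tmul_add, LinearMap.add_apply, hX, hY]
    | tmul d e =>
      simp [mulForm_tmul, biAct_tmul, antiα_tmul, QuasiHopfAlgebra.antipode_mul, mul_assoc]
  rw [slot3_tmul, slot3_tmul, key, key, inducedAct_β, trivialComul_apply,
    ← Algebra.TensorProduct.one_def, map_smul, map_one]
  simp

theorem mulForm_padRight_mul_slot1 (v : H →ₐ[k] B) (b b' : B) (U : H ⊗[k] (H ⊗[k] H)) :
    mulForm v b b' (padRight k H (Φ k H) * slot1 (Δ k H) U) =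
      prod2 (counitMap v) LinearMap.id (twoAct (inducedAct v) v U (b ⊗ₜ[k] b')) := by
  induction U using tensor_induction₃ with
  | add X Y hX hY => simp only [map_add, mul_add, LinearMap.add_apply, hX, hY]
  | tmul x y z =>
  have key : ∀ (D : H ⊗[k] H) (T : H ⊗[k] (H ⊗[k] H)),
      mulForm v b b' (padRight k H T * TensorProduct.assoc k H H (H ⊗[k] H) (D ⊗ₜ (y ⊗ₜ z))) =
        evalAct v T (biAct v D b) * biAct v (y ⊗ₜ z) b' := by
    intro D T
    induction D with
    | zero => simp
    | add X Y hX hY =>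
      simp only [map_add, add_mul, mul_add, TensorProduct.add_tmul, LinearMap.add_apply, hX, hY]
    | tmul d e =>
      induction T using tensor_induction₃ with
      | add X Y hX hY => simp only [map_add, add_mul, LinearMap.add_apply, hX, hY]
      | tmul p q r =>
        simp [padRight_tmul, mulForm_tmul, biAct_tmul, evalAct_tmul, antiα_tmul,
          QuasiHopfAlgebra.antipode_mul, mul_assoc]
  rw [slot1_tmul, key, twoAct_tmul, prod2_tmul]
  rfl

/-- `b ⋆ b' = θ(x¹ ▷ b) v(x²) b' v(S(x³))`, by the pentagon and the property of `α`. -/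
theorem inducedMul_eq_extend (v : H →ₐ[k] B) (b b' : B) :
    inducedMul v b b' = extend (inducedAct v) v (counitMap v) (b ⊗ₜ[k] b') := by
  rw [extend, LinearMap.comp_apply, ← mulForm_padRight_mul_slot1, padRight_mul_slot1, mul_assoc,
    mulForm_slot2_mul, slot2_trivialComul_inv, one_mul,
    inducedMul_eq_mulForm]

theorem inducedMul_β (v : H →ₐ[k] B) (b : B) : inducedMul v b (v (β k H)) = b := by
  rw [inducedMul_eq_mulForm, mulForm_mul_slot3, slot3_trivialComul, mul_one]
  have key : ∀ T : H ⊗[k] (H ⊗[k] H), mulForm v b (v (β k H)) (padLeft k H T) =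
      b * v (sandwich (S k H) (prod2 (LinearMap.mulRight k (β k H)) (S k H)) T (α k H)) := by
    intro T
    induction T using tensor_induction₃ with
    | add X Y hX hY => simp only [map_add, mul_add, LinearMap.add_apply, hX, hY]
    | tmul p q r =>
      simp [padLeft_apply, mulForm_tmul, antiα_tmul, sandwich_tmul, prod2_tmul, mul_assoc]
  rw [key, QuasiHopfAlgebra.reassociator_inv_antipode, map_one, mul_one]

theorem counitMap_β (v : H →ₐ[k] B) : counitMap v (v (β k H)) = 1 := by
  have key : ∀ T : H ⊗[k] (H ⊗[k] H), evalAct v T (v (β k H)) =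
      v (sandwich LinearMap.id (prod2 (LinearMap.mulRight k (α k H) ∘ₗ S k H) LinearMap.id)
        T (β k H)) := by
    intro T
    induction T using tensor_induction₃ with
    | add X Y hX hY => simp only [map_add, LinearMap.add_apply, hX, hY]
    | tmul p q r => simp [evalAct_tmul, antiα_tmul, sandwich_tmul, prod2_tmul]
  rw [counitMap, key, QuasiHopfAlgebra.reassociator_antipode, map_one]

theorem twoAct_one_left {ρ : H →ₐ[k] Module.End k M} {m : M} (hm : ∀ h, ρ h m = ε k H h • m)
    (v : H →ₐ[k] B) (b : B) : twoAct ρ v (Φinv k H) (m ⊗ₜ[k] b) = m ⊗ₜ[k] b := by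
  have key : ∀ T : H ⊗[k] (H ⊗[k] H), twoAct ρ v T (m ⊗ₜ[k] b) =
      m ⊗ₜ[k] biAct v (TensorProduct.lid k (H ⊗[k] H)
        (Algebra.TensorProduct.map (ε k H) (AlgHom.id k (H ⊗[k] H)) T)) b := by
    intro T
    induction T using tensor_induction₃ with
    | add X Y hX hY => simp only [map_add, TensorProduct.tmul_add, LinearMap.add_apply, hX, hY]
    | tmul p q r => simp [twoAct_tmul, hm, TensorProduct.smul_tmul]
  have h1 : (1 : k ⊗[k] (H ⊗[k] H)) = 1 ⊗ₜ[k] 1 := rfl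
  rw [key, map_Φinv_eq_one _ QuasiBialgebra.reassociator_counit₁, h1]
  simp

theorem extend_one_left {ρ : H →ₐ[k] Module.End k M} {v : H →ₐ[k] B} {γ : M →ₗ[k] B} {m : M}
    (hm : ∀ h, ρ h m = ε k H h • m) (b : B) : extend ρ v γ (m ⊗ₜ[k] b) = γ m * b := by
  rw [extend, LinearMap.comp_apply, twoAct_one_left hm, prod2_tmul]
  rfl

theorem inducedMul_β_left (v : H →ₐ[k] B) (b : B) : inducedMul v (v (β k H)) b = b := by
  rw [inducedMul_eq_extend, extend_one_left (inducedAct_β v), counitMap_β, one_mul]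

/-- The product `(m ⊗ n) ↦ γ(X¹ · m) γ'(X² · n) v(X³)` of two equivariant maps. -/
def convMap (ρ : H →ₐ[k] Module.End k M) (σ : H →ₐ[k] Module.End k N) (v : H →ₐ[k] B)
    (γ : M →ₗ[k] B) (γ' : N →ₗ[k] B) : M ⊗[k] N →ₗ[k] B :=
  prod2 γ (prod2 γ' v.toLinearMap) ∘ₗ
    (associator ρ σ (Algebra.lmul k H)).toLinearMap ∘ₗ (TensorProduct.mk k (M ⊗[k] N) H).flip 1

variable {ρ : H →ₐ[k] Module.End k M} {σ : H →ₐ[k] Module.End k N} {v : H →ₐ[k] B}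
  {γ : M →ₗ[k] B} {γ' : N →ₗ[k] B}

theorem convMap_tmul (m : M) (n : N) : convMap ρ σ v γ γ' (m ⊗ₜ[k] n) =
    prod2 γ (prod2 γ' v.toLinearMap)
      (tripleAct ρ σ (Algebra.lmul k H) (Φ k H) (m ⊗ₜ[k] (n ⊗ₜ[k] 1))) := rfl

/-- The action `(x ⊗ (y ⊗ T)) · (m ⊗ (n ⊗ b)) = x · m ⊗ (y · n ⊗ T · b)`. -/
def threeAct (ρ : H →ₐ[k] Module.End k M) (σ : H →ₐ[k] Module.End k N) (v : H →ₐ[k] B) :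
    H ⊗[k] (H ⊗[k] (H ⊗[k] H)) →ₐ[k] Module.End k (M ⊗[k] (N ⊗[k] B)) :=
  Module.endTensorEndAlgHom.comp (Algebra.TensorProduct.map ρ (twoAct σ v))

theorem threeAct_tmul (x : H) (T : H ⊗[k] (H ⊗[k] H)) (m : M) (s : N ⊗[k] B) :
    threeAct ρ σ v (x ⊗ₜ[k] T) (m ⊗ₜ[k] s) = ρ x m ⊗ₜ[k] twoAct σ v T s := rfl

theorem prod2_convMap (s : (M ⊗[k] N) ⊗[k] B) :
    prod2 (convMap ρ σ v γ γ') LinearMap.id s =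
      prod2 γ (prod2 γ' LinearMap.id)
        (threeAct ρ σ v (padRight k H (Φ k H)) (TensorProduct.assoc k M N B s)) := by
  induction s with
  | zero => simp
  | add X Y hX hY => simp only [map_add, hX, hY]
  | tmul s b =>
  induction s with
  | zero => simp
  | add X Y hX hY => simp only [map_add, TensorProduct.add_tmul, hX, hY]
  | tmul m n =>
  rw [prod2_tmul, convMap_tmul, TensorProduct.assoc_tmul]
  generalize Φ k H = T
  induction T using tensor_induction₃ with
  | add X Y hX hY => simp only [map_add, add_mul, LinearMap.add_apply, hX, hY]
  | tmul x y z =>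
    simp [padRight_tmul, threeAct_tmul, tripleAct_tmul, twoAct_tmul, prod2_tmul, biAct_tmul,
      QuasiHopfAlgebra.antipode_one, mul_assoc]

theorem assoc_twoAct (U : H ⊗[k] (H ⊗[k] H)) (s : (M ⊗[k] N) ⊗[k] B) :
    TensorProduct.assoc k M N B (twoAct (tensorAct ρ σ) v U s) =
      threeAct ρ σ v (slot1 (Δ k H) U) (TensorProduct.assoc k M N B s) := by
  induction s with
  | zero => simp
  | add X Y hX hY => simp only [map_add, hX, hY]
  | tmul s b =>
  induction s with
  | zero => simp
  | add X Y hX hY => simp only [map_add, TensorProduct.add_tmul, hX, hY]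
  | tmul m n =>
  induction U using tensor_induction₃ with
  | add X Y hX hY => simp only [map_add, LinearMap.add_apply, hX, hY]
  | tmul x y z =>
  rw [slot1_tmul, twoAct_tmul, tensorAct_apply]
  generalize Δ k H x = D
  induction D with
  | zero => simp
  | add X Y hX hY => simp only [map_add, TensorProduct.add_tmul, LinearMap.add_apply, hX, hY]
  | tmul p q => rfl

theorem associator_induced (s : (M ⊗[k] N) ⊗[k] B) :
    associator ρ σ (inducedAct v) s =
      threeAct ρ σ v (slot3 (Δ k H) (Φ k H)) (TensorProduct.assoc k M N B s) := by
  change tripleAct ρ σ (inducedAct v) (Φ k H) _ = _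
  generalize TensorProduct.assoc k M N B s = s
  generalize Φ k H = T
  congr 1
  induction T using tensor_induction₃ with
  | add X Y hX hY => simp only [map_add, hX, hY]
  | tmul x y z => rfl

theorem IsEquivariant.twoAct_prod2 (hγ' : IsEquivariant σ v γ') (U : H ⊗[k] (H ⊗[k] H))
    (s : M ⊗[k] (N ⊗[k] B)) :
    twoAct ρ v U ((prod2 γ' LinearMap.id).lTensor M s) =
      (prod2 γ' LinearMap.id).lTensor M (threeAct ρ σ v (slot2 (Δ k H) U) s) := by
  induction s with
  | zero => simp
  | add X Y hX hY => simp only [map_add, hX, hY]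
  | tmul m s =>
  induction U using tensor_induction₃ with
  | add X Y hX hY => simp only [map_add, LinearMap.add_apply, hX, hY]
  | tmul x y z =>
  rw [LinearMap.lTensor_tmul, twoAct_tmul, hγ'.biAct_prod2]
  rfl

theorem lTensor_twoAct (U : H ⊗[k] (H ⊗[k] H)) (s : M ⊗[k] (N ⊗[k] B)) :
    (twoAct σ v U).lTensor M s = threeAct ρ σ v (padLeft k H U) s := by
  induction s with
  | zero => simp
  | add X Y hX hY => simp only [map_add, hX, hY]
  | tmul m s => simp [padLeft_apply, threeAct_tmul]

/-- Extending the product of two equivariant maps amounts to extending them one after the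
other; this is where the pentagon enters the associativity of `B^v`. -/
theorem IsEquivariant.extend_convMap (hγ' : IsEquivariant σ v γ')
    (s : (M ⊗[k] N) ⊗[k] B) :
    extend (tensorAct ρ σ) v (convMap ρ σ v γ γ') s =
      extend ρ v γ ((extend σ v γ').lTensor M (associator ρ σ (inducedAct v) s)) := by
  rw [associator_induced]
  simp only [extend, LinearMap.lTensor_comp, LinearMap.comp_apply]
  rw [hγ'.twoAct_prod2, lTensor_twoAct (ρ := ρ), prod2_convMap, assoc_twoAct]
  simp only [← Module.End.mul_apply, ← map_mul]
  rw [padRight_mul_slot1, mul_assoc]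
  generalize threeAct ρ σ v _ _ = s
  induction s with
  | zero => simp
  | add X Y hX hY => simp only [map_add, hX, hY]
  | tmul m s => simp [prod2_tmul]

/-- The operator `m ⊗ b ↦ T¹ · m ⊗ v(T²) b v(S(T³) α T⁴)` on `M ⊗ B`. -/
def convForm (ρ : H →ₐ[k] Module.End k M) (v : H →ₐ[k] B) :
    H ⊗[k] (H ⊗[k] (H ⊗[k] H)) →ₗ[k] Module.End k (M ⊗[k] B) :=
  (Module.endTensorEndAlgHom (S := k) (R := k)).toLinearMap ∘ₗ
    TensorProduct.map ρ.toLinearMap (evalAct v)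

theorem convForm_tmul (x : H) (T : H ⊗[k] (H ⊗[k] H)) (m : M) (b : B) :
    convForm ρ v (x ⊗ₜ[k] T) (m ⊗ₜ[k] b) = ρ x m ⊗ₜ[k] evalAct v T b := rfl

theorem IsEquivariant.evalAct_prod2 (hγ : IsEquivariant ρ v γ) (T : H ⊗[k] (H ⊗[k] H))
    (s : M ⊗[k] B) :
    evalAct v T (prod2 γ LinearMap.id s) =
      prod2 γ LinearMap.id (convForm ρ v (slot1 (Δ k H) T) s) := by
  induction s with
  | zero => simp
  | add X Y hX hY => simp only [map_add, hX, hY]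
  | tmul m b =>
  induction T using tensor_induction₃ with
  | add X Y hX hY => simp only [map_add, LinearMap.add_apply, hX, hY]
  | tmul x y z =>
  rw [prod2_tmul, evalAct_tmul, slot1_tmul, ← mul_assoc, hγ x m]
  generalize Δ k H x = D
  induction D with
  | zero => simp
  | add X Y hX hY =>
    simp only [map_add, add_mul, TensorProduct.add_tmul, LinearMap.add_apply, hX, hY]
  | tmul p q => simp [prod2_tmul, convForm_tmul, evalAct_tmul, mul_assoc]

theorem convForm_twoAct (T : H ⊗[k] (H ⊗[k] (H ⊗[k] H))) (U : H ⊗[k] (H ⊗[k] H))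
    (s : M ⊗[k] B) :
    convForm ρ v T (twoAct ρ v U s) = convForm ρ v (T * padRight k H U) s := by
  induction s with
  | zero => simp
  | add X Y hX hY => simp only [map_add, hX, hY]
  | tmul m b =>
  induction U using tensor_induction₃ with
  | add X Y hX hY => simp only [map_add, mul_add, LinearMap.add_apply, hX, hY]
  | tmul x y z =>
  induction T using tensor_induction₄ with
  | add X Y hX hY => simp only [map_add, add_mul, LinearMap.add_apply, hX, hY]
  | tmul p q r t =>
    simp [padRight_tmul, twoAct_tmul, convForm_tmul, evalAct_tmul, biAct_tmul, antiα_tmul,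
      QuasiHopfAlgebra.antipode_mul, mul_assoc]

/-- `S(·) α ·` absorbs `Δ(T³)`. -/
theorem convForm_slot3_mul (T : H ⊗[k] (H ⊗[k] H)) (U : H ⊗[k] (H ⊗[k] (H ⊗[k] H))) :
    convForm ρ v (slot3 (Δ k H) T * U) = convForm ρ v (slot3 (trivialComul k H) T * U) := by
  induction T using tensor_induction₃ with
  | add X Y hX hY => simp only [map_add, add_mul, hX, hY]
  | tmul x y z =>
  induction U using tensor_induction₄ with
  | add X Y hX hY => simp only [map_add, mul_add, hX, hY]
  | tmul p q r s =>
  ext m b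
  simp only [slot3_tmul, Algebra.TensorProduct.tmul_mul_tmul, trivialComul_apply,
    ← Algebra.TensorProduct.one_def, smul_mul_assoc, one_mul,
    TensorProduct.AlgebraTensorModule.curry_apply, TensorProduct.curry_apply,
    LinearMap.restrictScalars_self, convForm_tmul, evalAct_tmul, antiα_comul_mul, map_smul]

theorem convForm_padLeft_mul_slot2 (T : H ⊗[k] (H ⊗[k] H)) (m : M) (b : B) :
    prod2 γ LinearMap.id (convForm ρ v (padLeft k H (Φ k H) * slot2 (Δ k H) T) (m ⊗ₜ[k] b)) =
      prod2 γ (prod2 (counitMap v) v.toLinearMap)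
      (tripleAct ρ (inducedAct v) (Algebra.lmul k H) T (m ⊗ₜ[k] (b ⊗ₜ[k] 1))) := by
  induction T using tensor_induction₃ with
  | add X Y hX hY => simp only [map_add, mul_add, LinearMap.add_apply, hX, hY]
  | tmul x y z =>
    rw [padLeft_apply, slot2_tmul, Algebra.TensorProduct.tmul_mul_tmul, one_mul, convForm_tmul,
      evalAct_mul_pure, tripleAct_tmul]
    simp [prod2_tmul, counitMap, inducedAct_apply]

/-- `θ(γ(x¹ · m) v(x²) b v(S(x³))) = γ(X¹ · m) θ(X² ▷ b) v(X³)`: the equivariant map that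
corresponds to `extend ρ v γ` is the product of `γ` and `θ`. -/
theorem IsEquivariant.counitMap_extend (hγ : IsEquivariant ρ v γ) (s : M ⊗[k] B) :
    counitMap v (extend ρ v γ s) = convMap ρ (inducedAct v) v γ (counitMap v) s := by
  rw [counitMap, extend, LinearMap.comp_apply, hγ.evalAct_prod2, convForm_twoAct,
    slot1_mul_padRight, mul_assoc, convForm_slot3_mul,
    slot3_trivialComul_inv, one_mul]
  induction s with
  | zero => simp
  | add X Y hX hY => simp only [map_add, hX, hY]
  | tmul m b => rw [convForm_padLeft_mul_slot2, convMap_tmul, counitMap]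

theorem rTensor_twoAct {f : M →ₗ[k] N} (hf : ∀ h m, f (ρ h m) = σ h (f m))
    (T : H ⊗[k] (H ⊗[k] H)) (s : M ⊗[k] B) :
    f.rTensor B (twoAct ρ v T s) = twoAct σ v T (f.rTensor B s) := by
  induction s with
  | zero => simp
  | add X Y hX hY => simp only [map_add, hX, hY]
  | tmul m b =>
  induction T using tensor_induction₃ with
  | add X Y hX hY => simp only [map_add, LinearMap.add_apply, hX, hY]
  | tmul x y z => simp [twoAct_tmul, hf]

/-- `extend` is natural in the `H`-module. -/
theorem extend_comp {f : M →ₗ[k] N} (hf : ∀ h m, f (ρ h m) = σ h (f m)) (s : M ⊗[k] B) :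
    extend ρ v (γ' ∘ₗ f) s = extend σ v γ' (f.rTensor B s) := by
  simp only [extend, LinearMap.comp_apply]
  rw [← rTensor_twoAct hf]
  generalize twoAct ρ v (Φinv k H) s = s
  induction s with
  | zero => simp
  | add X Y hX hY => simp only [map_add, hX, hY]
  | tmul m b => simp [prod2_tmul]

theorem induced_μ (v : H →ₐ[k] B) :
    (induced v).μ = extend (inducedAct v) v (counitMap v) := by
  ext b b'
  exact inducedMul_eq_extend v b b'

/-- `B^v` is a left `H`-module algebra. -/
theorem induced_isModuleAlgebra (v : H →ₐ[k] B) : (induced v).IsModuleAlgebra where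
  mul_assoc a b c := by
    have hθ := counitMap_isEquivariant v
    have h1 : convMap (inducedAct v) (inducedAct v) v (counitMap v) (counitMap v) =
        counitMap v ∘ₗ (induced v).μ := by
      refine LinearMap.ext fun s => ?_
      rw [LinearMap.comp_apply, induced_μ, hθ.counitMap_extend]
    have h2 := hθ.extend_convMap (γ := counitMap v) (ρ := inducedAct v)
      ((a ⊗ₜ[k] b) ⊗ₜ[k] c)
    rw [h1, extend_comp (ρ := tensorAct (inducedAct v) (inducedAct v)) (σ := inducedAct v),
      ← induced_μ] at h2
    · exact h2
    · intro h m
      rw [induced_μ, hθ.extend_act]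
  one_mul a := inducedMul_β_left v a
  mul_one a := inducedMul_β v a
  act_mul h a b := by
    have := (counitMap_isEquivariant v).extend_act h (a ⊗ₜ[k] b)
    rw [← induced_μ] at this
    exact this
  act_one h := inducedAct_β v h

end Product

/-! ### Factorizations of an algebra through two subalgebras -/

section Factorization

variable {k : Type u} {H : Type v} [Field k] [Ring H] [Algebra k H]
variable {M N L M' N' L' : Type*} [AddCommGroup M] [Module k M] [AddCommGroup N] [Module k N]
  [AddCommGroup L] [Module k L] [AddCommGroup M'] [Module k M'] [AddCommGroup N'] [Module k N']
  [AddCommGroup L'] [Module k L']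
variable {A B C : Type*} [AddCommGroup A] [Module k A] [AddCommGroup B] [Module k B]
  [AddCommGroup C] [Module k C]

/-- `f` is `H`-linear. -/
def IsHLinear (ρ : H →ₐ[k] Module.End k M) (σ : H →ₐ[k] Module.End k N) (f : M →ₗ[k] N) : Prop :=
  ∀ (h : H) (m : M), f (ρ h m) = σ h (f m)

/-- The product `m ⊗ n ↦ f(m) g(n)` of two linear maps into `𝒞`. -/
def mulMap (𝒞 : HModuleData k H C) (f : M →ₗ[k] C) (g : N →ₗ[k] C) : M ⊗[k] N →ₗ[k] C :=
  𝒞.μ ∘ₗ TensorProduct.map f g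

variable {𝒜 : HModuleData k H A} {𝒞 : HModuleData k H C}

theorem mulMap_tmul (f : M →ₗ[k] C) (g : N →ₗ[k] C) (m : M) (n : N) :
    mulMap 𝒞 f g (m ⊗ₜ[k] n) = 𝒞.mul (f m) (g n) := rfl

theorem mulMap_rTensor (f : M' →ₗ[k] C) (g : N →ₗ[k] C) (e : M →ₗ[k] M') (s : M ⊗[k] N) :
    mulMap 𝒞 f g (e.rTensor N s) = mulMap 𝒞 (f ∘ₗ e) g s := by
  simp only [mulMap, LinearMap.comp_apply, ← LinearMap.map_comp_rTensor]

theorem mulMap_lTensor (f : M →ₗ[k] C) (g : N' →ₗ[k] C) (e : N →ₗ[k] N') (s : M ⊗[k] N) :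
    mulMap 𝒞 f g (e.lTensor M s) = mulMap 𝒞 f (g ∘ₗ e) s := by
  simp only [mulMap, LinearMap.comp_apply, ← LinearMap.map_comp_lTensor]

theorem mulMap_map (f : M' →ₗ[k] C) (g : N' →ₗ[k] C) (d : M →ₗ[k] M') (e : N →ₗ[k] N')
    (s : M ⊗[k] N) :
    mulMap 𝒞 f g (TensorProduct.map d e s) = mulMap 𝒞 (f ∘ₗ d) (g ∘ₗ e) s := by
  simp only [mulMap, LinearMap.comp_apply, TensorProduct.map_comp]

/-- `f` is a morphism of left `H`-module algebras. -/
structure IsModuleAlgebraHom (𝒜 : HModuleData k H A) (ℬ : HModuleData k H B) (f : A →ₗ[k] B) :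
    Prop where
  map_act : IsHLinear 𝒜.act ℬ.act f
  map_mul : ∀ a b : A, f (𝒜.mul a b) = ℬ.mul (f a) (f b)
  map_one : f 𝒜.one = ℬ.one

theorem IsModuleAlgebraHom.comp_μ {f : A →ₗ[k] C} (hf : IsModuleAlgebraHom 𝒜 𝒞 f) :
    f ∘ₗ 𝒜.μ = mulMap 𝒞 f f := by
  refine TensorProduct.ext' fun a b => ?_
  exact hf.map_mul a b

variable [QuasiBialgebra k H]
variable {ρ : H →ₐ[k] Module.End k M} {σ : H →ₐ[k] Module.End k N} {τ : H →ₐ[k] Module.End k L}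
  {ρ' : H →ₐ[k] Module.End k M'} {σ' : H →ₐ[k] Module.End k N'} {τ' : H →ₐ[k] Module.End k L'}

theorem IsHLinear.map {f : M →ₗ[k] M'} {g : N →ₗ[k] N'} (hf : IsHLinear ρ ρ' f)
    (hg : IsHLinear σ σ' g) :
    IsHLinear (tensorAct ρ σ) (tensorAct ρ' σ') (TensorProduct.map f g) := by
  intro h s
  rw [tensorAct_apply, tensorAct_apply]
  generalize Δ k H h = D
  induction s with
  | zero => simp
  | add X Y hX hY => simp only [map_add, hX, hY]
  | tmul m n =>
  induction D with
  | zero => simp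
  | add X Y hX hY => simp only [map_add, LinearMap.add_apply, hX, hY]
  | tmul x y => simp [Module.endTensorEndAlgHom_apply, hf x, hg y]

theorem associator_naturality {f : M →ₗ[k] M'} {g : N →ₗ[k] N'} {e : L →ₗ[k] L'}
    (hf : IsHLinear ρ ρ' f) (hg : IsHLinear σ σ' g) (he : IsHLinear τ τ' e)
    (s : (M ⊗[k] N) ⊗[k] L) :
    TensorProduct.map f (TensorProduct.map g e) (associator ρ σ τ s) =
      associator ρ' σ' τ' (TensorProduct.map (TensorProduct.map f g) e s) := by
  induction s with
  | zero => simp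
  | add X Y hX hY => simp only [map_add, hX, hY]
  | tmul s l =>
  induction s with
  | zero => simp
  | add X Y hX hY => simp only [map_add, TensorProduct.add_tmul, hX, hY]
  | tmul m n =>
  rw [TensorProduct.map_tmul, TensorProduct.map_tmul, associator_tmul, associator_tmul]
  generalize Φ k H = T
  induction T using tensor_induction₃ with
  | add X Y hX hY => simp only [map_add, LinearMap.add_apply, hX, hY]
  | tmul x y z => simp [tripleAct_tmul, hf x, hg y, he z]

variable {ℬ : HModuleData k H B}

theorem HModuleData.IsModuleAlgebra.μ_isHLinear (h𝒜 : 𝒜.IsModuleAlgebra) :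
    IsHLinear (tensorAct 𝒜.act 𝒜.act) 𝒜.act 𝒜.μ := by
  intro h s
  induction s with
  | zero => simp
  | add X Y hX hY => simp only [map_add, hX, hY]
  | tmul m n => exact (h𝒜.act_mul h m n).symm

theorem IsHLinear.mulMap (h𝒞 : 𝒞.IsModuleAlgebra) {f : M →ₗ[k] C} {g : N →ₗ[k] C}
    (hf : IsHLinear ρ 𝒞.act f) (hg : IsHLinear σ 𝒞.act g) :
    IsHLinear (tensorAct ρ σ) 𝒞.act (mulMap 𝒞 f g) := by
  intro h s
  rw [QuasiHopf.mulMap, LinearMap.comp_apply, LinearMap.comp_apply, hf.map hg h, h𝒞.μ_isHLinear]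

theorem mulMap_assoc (h𝒞 : 𝒞.IsModuleAlgebra) {f : M →ₗ[k] C} {g : N →ₗ[k] C} {e : L →ₗ[k] C}
    (hf : IsHLinear ρ 𝒞.act f) (hg : IsHLinear σ 𝒞.act g) (he : IsHLinear τ 𝒞.act e)
    (s : (M ⊗[k] N) ⊗[k] L) :
    mulMap 𝒞 (mulMap 𝒞 f g) e s = mulMap 𝒞 f (mulMap 𝒞 g e) (associator ρ σ τ s) := by
  have h1 : mulMap 𝒞 f (mulMap 𝒞 g e) (associator ρ σ τ s) =
      𝒞.μ (𝒞.μ.lTensor C (TensorProduct.map f (TensorProduct.map g e) (associator ρ σ τ s))) := by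
    rw [← LinearMap.comp_apply (𝒞.μ.lTensor C), LinearMap.lTensor_comp_map]
    rfl
  rw [h1, associator_naturality hf hg he]
  clear h1
  induction s with
  | zero => simp
  | add X Y hX hY => simp only [map_add, hX, hY]
  | tmul s l =>
  induction s with
  | zero => simp
  | add X Y hX hY => simp only [map_add, TensorProduct.add_tmul, hX, hY]
  | tmul m n => exact h𝒞.mul_assoc (f m) (g n) (e l)

/-- The axioms of a left `H`-module algebra can be transported along an isomorphism. -/
theorem IsModuleAlgebraIso.isModuleAlgebra {f : A →ₗ[k] C} (hf : IsModuleAlgebraIso 𝒜 𝒞 f)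
    (h𝒞 : 𝒞.IsModuleAlgebra) : 𝒜.IsModuleAlgebra := by
  have hf' : IsModuleAlgebraHom 𝒜 𝒞 f := ⟨hf.map_act, hf.map_mul, hf.map_one⟩
  have inj := hf.bijective.injective
  constructor
  · intro a b c
    apply inj
    have h1 := mulMap_assoc h𝒞 hf'.map_act hf'.map_act hf'.map_act ((a ⊗ₜ[k] b) ⊗ₜ[k] c)
    rw [mulMap_tmul, mulMap_tmul, ← hf.map_mul, ← hf.map_mul, ← hf'.comp_μ, ← mulMap_lTensor,
      ← hf'.comp_μ] at h1
    exact h1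
  · intro a
    apply inj
    rw [hf.map_mul, hf.map_one, h𝒞.one_mul]
  · intro a
    apply inj
    rw [hf.map_mul, hf.map_one, h𝒞.mul_one]
  · intro h a b
    apply inj
    have h1 := hf'.map_act.mulMap h𝒞 hf'.map_act h (a ⊗ₜ[k] b)
    rw [mulMap_tmul, ← hf.map_mul, ← hf.map_act, ← hf'.comp_μ] at h1
    exact h1.symm
  · intro h
    apply inj
    rw [hf.map_act, hf.map_one, h𝒞.act_one, map_smul, hf.map_one]

variable {f : A →ₗ[k] C} {g : B →ₗ[k] C} {R : B ⊗[k] A →ₗ[k] A ⊗[k] B}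

/-- If `a ⊗ b ↦ f(a) g(b)` is injective, then a map `R` that expresses the products `g(b) f(a)`
through the products `f(a) g(b)` is a twisting map. -/
theorem isTwistingMap_of_factorization (h𝒞 : 𝒞.IsModuleAlgebra)
    (hf : IsModuleAlgebraHom 𝒜 𝒞 f) (hg : IsModuleAlgebraHom ℬ 𝒞 g)
    (inj : Function.Injective (mulMap 𝒞 f g))
    (hR : mulMap 𝒞 f g ∘ₗ R = mulMap 𝒞 g f) : IsTwistingMap 𝒜 ℬ R := by
  have hR' : ∀ s, mulMap 𝒞 f g (R s) = mulMap 𝒞 g f s := LinearMap.congr_fun hR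
  constructor
  · intro h t
    apply inj
    rw [hR', hg.map_act.mulMap h𝒞 hf.map_act, hf.map_act.mulMap h𝒞 hg.map_act, hR']
  · intro b
    apply inj
    rw [hR', mulMap_tmul, mulMap_tmul, hf.map_one, h𝒞.mul_one, h𝒞.one_mul]
  · intro a
    apply inj
    rw [hR', mulMap_tmul, mulMap_tmul, hg.map_one, h𝒞.mul_one, h𝒞.one_mul]
  · refine LinearMap.ext fun t => inj ?_
    simp only [LinearMap.comp_apply, LinearEquiv.coe_coe]
    rw [hR', mulMap_rTensor, hg.comp_μ, mulMap_assoc h𝒞 hg.map_act hg.map_act hf.map_act,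
      mulMap_lTensor, hg.comp_μ, ← mulMap_assoc h𝒞 hf.map_act hg.map_act hg.map_act,
      mulMap_rTensor, hR, mulMap_assoc h𝒞 hg.map_act hf.map_act hg.map_act,
      LinearEquiv.apply_symm_apply, mulMap_lTensor, hR]
  · refine LinearMap.ext fun t => inj ?_
    simp only [LinearMap.comp_apply, LinearEquiv.coe_coe]
    rw [hR', mulMap_lTensor, hf.comp_μ, mulMap_rTensor, hf.comp_μ,
      mulMap_assoc h𝒞 hf.map_act hf.map_act hg.map_act, LinearEquiv.apply_symm_apply,
      mulMap_lTensor, hR, ← mulMap_assoc h𝒞 hf.map_act hg.map_act hf.map_act,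
      mulMap_rTensor, hR, mulMap_assoc h𝒞 hg.map_act hf.map_act hf.map_act,
      LinearEquiv.apply_symm_apply]

/-- In the situation of `isTwistingMap_of_factorization`, the map `a ⊗ b ↦ f(a) g(b)` is an
isomorphism from the twisted tensor product if it is bijective. -/
theorem isModuleAlgebraIso_of_factorization (h𝒞 : 𝒞.IsModuleAlgebra)
    (hf : IsModuleAlgebraHom 𝒜 𝒞 f) (hg : IsModuleAlgebraHom ℬ 𝒞 g)
    (bij : Function.Bijective (mulMap 𝒞 f g))
    (hR : mulMap 𝒞 f g ∘ₗ R = mulMap 𝒞 g f) :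
    IsModuleAlgebraIso (twistedTensor 𝒜 ℬ R) 𝒞 (mulMap 𝒞 f g) where
  bijective := bij
  map_act := hf.map_act.mulMap h𝒞 hg.map_act
  map_mul s t := by
    have hfg := hf.map_act.mulMap h𝒞 hg.map_act
    have hgg := hg.map_act.mulMap h𝒞 hg.map_act
    have e1 : mulMap 𝒞 f (mulMap 𝒞 g g) ∘ₗ (associator 𝒜.act ℬ.act ℬ.act).toLinearMap =
        mulMap 𝒞 (mulMap 𝒞 f g) g :=
      LinearMap.ext fun s => (mulMap_assoc h𝒞 hf.map_act hg.map_act hg.map_act s).symm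
    have e2 : mulMap 𝒞 (mulMap 𝒞 f g) g ∘ₗ R.rTensor B = mulMap 𝒞 (mulMap 𝒞 g f) g :=
      LinearMap.ext fun s => by rw [LinearMap.comp_apply, mulMap_rTensor, hR]
    have e3 : mulMap 𝒞 (mulMap 𝒞 g f) g ∘ₗ (associator ℬ.act 𝒜.act ℬ.act).symm.toLinearMap =
        mulMap 𝒞 g (mulMap 𝒞 f g) :=
      LinearMap.ext fun s => by
        rw [LinearMap.comp_apply, mulMap_assoc h𝒞 hg.map_act hf.map_act hg.map_act,
          LinearEquiv.coe_coe, LinearEquiv.apply_symm_apply]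
    change mulMap 𝒞 f g (TensorProduct.map 𝒜.μ ℬ.μ
      ((associator 𝒜.act 𝒜.act (tensorAct ℬ.act ℬ.act)).symm
      ((associator 𝒜.act ℬ.act ℬ.act).toLinearMap.lTensor A
      ((R.rTensor B).lTensor A
      ((associator ℬ.act 𝒜.act ℬ.act).symm.toLinearMap.lTensor A
      (associator 𝒜.act ℬ.act (tensorAct 𝒜.act ℬ.act) (s ⊗ₜ[k] t))))))) = _
    rw [mulMap_map, hf.comp_μ, hg.comp_μ, mulMap_assoc h𝒞 hf.map_act hf.map_act hgg,
      LinearEquiv.apply_symm_apply, mulMap_lTensor, e1, mulMap_lTensor, e2, mulMap_lTensor, e3,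
      ← mulMap_assoc h𝒞 hf.map_act hg.map_act hfg, mulMap_tmul]
  map_one := by
    change mulMap 𝒞 f g (𝒜.one ⊗ₜ[k] ℬ.one) = _
    rw [mulMap_tmul, hf.map_one, hg.map_one, h𝒞.one_mul]

end Factorization

/-! ### The two subalgebras of `(A # H)^j` -/

section SmashFactorization

variable {k : Type u} {H : Type v} [Field k] [Ring H] [Algebra k H]
variable {A : Type*} [AddCommGroup A] [Module k A]

section QuasiBialgebra

variable [QuasiBialgebra k H] {𝒜 : HModuleData k H A} (h𝒜 : 𝒜.IsModuleAlgebra)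

/-- The map `x ⊗ y ↦ x · a # y`. -/
def smashEval (a : A) : H ⊗[k] H →ₗ[k] SmashProduct h𝒜 :=
  (toSmash h𝒜).toLinearMap ∘ₗ TensorProduct.map (𝒜.act.toLinearMap.flip a) LinearMap.id

theorem smashEval_tmul (a : A) (x y : H) :
    smashEval h𝒜 a (x ⊗ₜ[k] y) = toSmash h𝒜 (𝒜.act x a ⊗ₜ[k] y) := rfl

theorem smashJ_apply (h : H) : smashJ h𝒜 h = toSmash h𝒜 (𝒜.one ⊗ₜ[k] h) := rfl

theorem smashJ_mul_smashEval (h : H) (a : A) (T : H ⊗[k] H) :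
    smashJ h𝒜 h * smashEval h𝒜 a T = smashEval h𝒜 a (Δ k H h * T) := by
  induction T with
  | zero => simp
  | add X Y hX hY => simp only [map_add, mul_add, hX, hY]
  | tmul x y =>
  have h1 : (1 : k ⊗[k] (H ⊗[k] H)) = 1 ⊗ₜ[k] 1 := rfl
  rw [smashJ_apply, smashEval_tmul, toSmash_mul, smashMul_tmul, smashTri_one_left h𝒜, map_mul,
    map_Φinv_eq_one _ QuasiBialgebra.reassociator_counit₁, one_mul,
    Algebra.TensorProduct.map_tmul, map_one, TensorProduct.lid_tmul, one_smul, AlgHom.id_apply]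
  generalize Δ k H h = D
  induction D with
  | zero => simp
  | add X Y hX hY => simp only [map_add, add_mul, hX, hY]
  | tmul p q => simp [smashEval_tmul]

theorem smashEval_mul_smashJ (h : H) (a : A) (T : H ⊗[k] H) :
    smashEval h𝒜 a T * smashJ h𝒜 h = smashEval h𝒜 a (T * (1 ⊗ₜ h)) := by
  induction T with
  | zero => simp
  | add X Y hX hY => simp only [map_add, add_mul, hX, hY]
  | tmul x y =>
  have key : ∀ D : H ⊗[k] H, TensorProduct.lid k H (Algebra.TensorProduct.map (ε k H)
      (AlgHom.id k H) (D * (1 ⊗ₜ[k] h))) =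
      TensorProduct.lid k H (Algebra.TensorProduct.map (ε k H) (AlgHom.id k H) D) * h := by
    intro D
    induction D with
    | zero => simp
    | add X Y hX hY => simp only [map_add, add_mul, hX, hY]
    | tmul p q => simp
  rw [smashJ_apply, smashEval_tmul, toSmash_mul, smashMul_tmul, smashTri_one_right h𝒜, map_mul,
    map_Φinv_eq_one _ QuasiBialgebra.reassociator_counit₂, one_mul,
    Algebra.TensorProduct.map_tmul, TensorProduct.map_tmul, LinearEquiv.coe_coe, key,
    QuasiBialgebra.counit_left]
  simp [smashEval_tmul]

/-- The inclusion `A → A # H`, `a ↦ a # 1`. -/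
def smashIncl : A →ₗ[k] SmashProduct h𝒜 :=
  (toSmash h𝒜).toLinearMap ∘ₗ (TensorProduct.mk k A H).flip 1

theorem smashIncl_apply (a : A) : smashIncl h𝒜 a = smashEval h𝒜 a 1 := by
  simp [Algebra.TensorProduct.one_def, smashEval_tmul, smashIncl]

theorem smashIncl_mul_smashJ (a : A) (h : H) :
    smashIncl h𝒜 a * smashJ h𝒜 h = toSmash h𝒜 (a ⊗ₜ[k] h) := by
  rw [smashIncl_apply, smashEval_mul_smashJ, one_mul, smashEval_tmul]
  simp

end QuasiBialgebra

variable [QuasiHopfAlgebra k H] {𝒜 : HModuleData k H A} (h𝒜 : 𝒜.IsModuleAlgebra)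

theorem smashIncl_isEquivariant : IsEquivariant 𝒜.act (smashJ h𝒜) (smashIncl h𝒜) := by
  intro h a
  rw [smashIncl_apply, smashJ_mul_smashEval, mul_one]
  generalize Δ k H h = D
  induction D with
  | zero => simp
  | add X Y hX hY => simp only [map_add, hX, hY]
  | tmul x y => simp [prod2_tmul, smashIncl_mul_smashJ, smashEval_tmul]

/-- `(X¹ · a # 1)(X² · b # 1)(1 # X³) = ab # 1` -/
theorem convMap_smashIncl :
    convMap 𝒜.act 𝒜.act (smashJ h𝒜) (smashIncl h𝒜) (smashIncl h𝒜) =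
      smashIncl h𝒜 ∘ₗ 𝒜.μ := by
  refine TensorProduct.ext' fun a b => ?_
  have aux : ∀ (p q r : H) (T : H ⊗[k] (H ⊗[k] H)),
      smashTri 𝒜 (𝒜.act p a) (𝒜.act q b) (T * (1 ⊗ₜ[k] (1 ⊗ₜ[k] r))) =
        smashTri 𝒜 a b (T * (p ⊗ₜ[k] (q ⊗ₜ[k] r))) := by
    intro p q r T
    induction T using tensor_induction₃ with
    | add X Y hX hY => simp only [map_add, add_mul, hX, hY]
    | tmul x y z => simp [smashTri_tmul]
  have key : ∀ T : H ⊗[k] (H ⊗[k] H),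
      prod2 (smashIncl h𝒜) (prod2 (smashIncl h𝒜) (smashJ h𝒜).toLinearMap)
        (tripleAct 𝒜.act 𝒜.act (Algebra.lmul k H) T (a ⊗ₜ[k] (b ⊗ₜ[k] 1))) =
      toSmash h𝒜 (smashTri 𝒜 a b (Φinv k H * T)) := by
    intro T
    induction T using tensor_induction₃ with
    | add X Y hX hY => simp only [map_add, mul_add, LinearMap.add_apply, hX, hY]
    | tmul x y z =>
      rw [tripleAct_tmul, prod2_tmul, prod2_tmul, AlgHom.toLinearMap_apply, smashIncl_mul_smashJ,
        ← aux x y z]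
      change toSmash h𝒜 (smashMul 𝒜 (𝒜.act x a ⊗ₜ[k] 1) (𝒜.act y b ⊗ₜ[k] (z * 1))) = _
      rw [smashMul_tmul, map_one, one_mul, mul_one]
  rw [convMap_tmul, key, Units.inv_mul]
  change toSmash h𝒜 (smashTri 𝒜 a b (1 ⊗ₜ[k] (1 ⊗ₜ[k] 1))) = _
  rw [smashTri_tmul, map_one]
  rfl

theorem conjMap_eq_twoAct (𝒜 : HModuleData k H A) (T : H ⊗[k] (H ⊗[k] H)) :
    conjMap 𝒜 T = twoAct 𝒜.act (AlgHom.id k H) T := rfl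

/-- `Π(a ⊗ h) = (x¹ · a # 1) j(x² h S(x³))` -/
theorem smashPi_eq_extend (s : A ⊗[k] H) :
    smashPi h𝒜 s = extend 𝒜.act (smashJ h𝒜) (smashIncl h𝒜)
      ((smashJ h𝒜).toLinearMap.lTensor A s) := by
  induction s with
  | zero => simp
  | add X Y hX hY => simp only [map_add, hX, hY]
  | tmul a h =>
  rw [smashPi, extend, LinearMap.comp_apply, LinearMap.comp_apply, conjMap_eq_twoAct]
  generalize Φinv k H = T
  induction T using tensor_induction₃ with
  | add X Y hX hY =>
    simp only [map_add, LinearMap.add_apply, hX, hY]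
  | tmul x y z =>
    rw [twoAct_tmul, biAct_tmul, LinearMap.lTensor_tmul, twoAct_tmul, prod2_tmul, biAct_tmul]
    simp only [LinearMap.id_apply, AlgHom.toLinearMap_apply, ← map_mul, smashIncl_mul_smashJ]
    rfl

theorem smashPi_bijective : Function.Bijective (smashPi h𝒜) := by
  rw [smashPi, LinearMap.coe_comp]
  refine (toSmash h𝒜).bijective.comp ?_
  rw [conjMap_eq_twoAct]
  refine Function.bijective_iff_has_inverse.mpr ⟨twoAct 𝒜.act (AlgHom.id k H) (Φ k H), ?_, ?_⟩
  · intro s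
    rw [← Module.End.mul_apply, ← map_mul, Units.mul_inv, map_one]
    rfl
  · intro s
    rw [← Module.End.mul_apply, ← map_mul, Units.inv_mul, map_one]
    rfl

variable {B B' : Type*} [Ring B] [Algebra k B] [Ring B'] [Algebra k B']

theorem map_biAct (v : H →ₐ[k] B) (f : B →ₐ[k] B') (D : H ⊗[k] H) (b : B) :
    f (biAct v D b) = biAct (f.comp v) D (f b) := by
  induction D with
  | zero => simp
  | add X Y hX hY => simp only [map_add, LinearMap.add_apply, hX, hY]
  | tmul x y => simp [biAct_tmul]

theorem map_inducedMul (v : H →ₐ[k] B) (f : B →ₐ[k] B') (b b' : B) :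
    f (inducedMul v b b') = inducedMul (f.comp v) (f b) (f b') := by
  rw [inducedMul_eq_mulForm, inducedMul_eq_mulForm]
  generalize padLeft k H (Φinv k H) * slot3 (Δ k H) (Φ k H) = T
  induction T using tensor_induction₄ with
  | add X Y hX hY => simp only [map_add, hX, hY]
  | tmul x y z t => simp [mulForm_tmul]

/-- An algebra map `f : B → B'` is a morphism `B^v → B'^{f v}`. -/
theorem isModuleAlgebraHom_induced (v : H →ₐ[k] B) (f : B →ₐ[k] B') :
    IsModuleAlgebraHom (induced v) (induced (f.comp v)) f.toLinearMap where
  map_act h b := map_biAct v f (Δ k H h) b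
  map_mul b b' := map_inducedMul v f b b'
  map_one := rfl

theorem smashJ_isModuleAlgebraHom :
    IsModuleAlgebraHom (H0 k H) (smashInduced h𝒜) (smashJ h𝒜).toLinearMap :=
  isModuleAlgebraHom_induced (AlgHom.id k H) (smashJ h𝒜)

/-- The map `ι(a) = x¹ · a # x² β S(x³)`, the `H`-linear map `A → (A # H)^j` that corresponds to
the equivariant map `a ↦ a # 1`. -/
def smashIota : A →ₗ[k] SmashProduct h𝒜 :=
  extend 𝒜.act (smashJ h𝒜) (smashIncl h𝒜) ∘ₗ (TensorProduct.mk k A _).flip (smashJ h𝒜 (β k H))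

section UnitFactor

variable {M N L : Type*} [AddCommGroup M] [Module k M] [AddCommGroup N] [Module k N]
  [AddCommGroup L] [Module k L]
  {ρ : H →ₐ[k] Module.End k M} {σ : H →ₐ[k] Module.End k N} {τ : H →ₐ[k] Module.End k L}

theorem tensorAct_one_right {n : N} (hn : ∀ h, σ h n = ε k H h • n) (h : H) (m : M) :
    tensorAct ρ σ h (m ⊗ₜ[k] n) = ρ h m ⊗ₜ[k] n := by
  have key : ∀ D : H ⊗[k] H, Module.endTensorEndAlgHom (S := k)
      (Algebra.TensorProduct.map ρ σ D) (m ⊗ₜ[k] n) =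
      ρ (TensorProduct.rid k H (Algebra.TensorProduct.map (AlgHom.id k H) (ε k H) D)) m
        ⊗ₜ[k] n := by
    intro D
    induction D with
    | zero => simp
    | add X Y hX hY => simp only [map_add, TensorProduct.add_tmul, LinearMap.add_apply, hX, hY]
    | tmul x y => simp [Module.endTensorEndAlgHom_apply, hn, TensorProduct.smul_tmul]
  rw [tensorAct_apply, key, QuasiBialgebra.counit_right]
  simp

theorem associator_one_right {l : L} (hl : ∀ h, τ h l = ε k H h • l) (m : M) (n : N) :
    associator ρ σ τ ((m ⊗ₜ[k] n) ⊗ₜ[k] l) = m ⊗ₜ[k] (n ⊗ₜ[k] l) := by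
  have key : ∀ T : H ⊗[k] (H ⊗[k] H), tripleAct ρ σ τ T (m ⊗ₜ[k] (n ⊗ₜ[k] l)) =
      TensorProduct.map (ρ.toLinearMap.flip m) (TensorProduct.map (σ.toLinearMap.flip n)
        (LinearMap.toSpanSingleton k L l))
        (Algebra.TensorProduct.map (AlgHom.id k H)
          (Algebra.TensorProduct.map (AlgHom.id k H) (ε k H)) T) := by
    intro T
    induction T using tensor_induction₃ with
    | add X Y hX hY => simp only [map_add, LinearMap.add_apply, hX, hY]
    | tmul x y z => simp [tripleAct_tmul, hl]
  have h1 : (1 : H ⊗[k] (H ⊗[k] k)) = 1 ⊗ₜ[k] (1 ⊗ₜ[k] 1) := rfl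
  rw [associator_tmul, key, QuasiBialgebra.reassociator_counit₃, h1]
  simp

theorem convMap_one_right {v : H →ₐ[k] B} {γ : M →ₗ[k] B} {γ' : N →ₗ[k] B} {n : N}
    (hn : ∀ h, σ h n = ε k H h • n) (m : M) :
    convMap ρ σ v γ γ' (m ⊗ₜ[k] n) = γ m * γ' n := by
  have key : ∀ T : H ⊗[k] (H ⊗[k] H),
      prod2 γ (prod2 γ' v.toLinearMap)
        (tripleAct ρ σ (Algebra.lmul k H) T (m ⊗ₜ[k] (n ⊗ₜ[k] 1))) =
      prod2 (γ ∘ₗ ρ.toLinearMap.flip m) (prod2 (LinearMap.toSpanSingleton k B (γ' n)) v.toLinearMap)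
        (Algebra.TensorProduct.map (AlgHom.id k H)
          (Algebra.TensorProduct.map (ε k H) (AlgHom.id k H)) T) := by
    intro T
    induction T using tensor_induction₃ with
    | add X Y hX hY => simp only [map_add, LinearMap.add_apply, hX, hY]
    | tmul x y z => simp [tripleAct_tmul, hn, prod2_tmul]
  have h1 : (1 : H ⊗[k] (k ⊗[k] H)) = 1 ⊗ₜ[k] (1 ⊗ₜ[k] 1) := rfl
  rw [convMap_tmul, key, QuasiBialgebra.reassociator_counit₂, h1]
  simp [prod2_tmul]

end UnitFactor

theorem smashIota_isHLinear : IsHLinear 𝒜.act (smashInduced h𝒜).act (smashIota h𝒜) := by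
  intro h a
  have h1 := (smashIncl_isEquivariant h𝒜).extend_act h (a ⊗ₜ[k] smashJ h𝒜 (β k H))
  rw [tensorAct_one_right (inducedAct_β (smashJ h𝒜))] at h1
  exact h1.symm

/-- `θ(ι(a)) = a # 1` -/
theorem counitMap_smashIota :
    counitMap (smashJ h𝒜) ∘ₗ smashIota h𝒜 = smashIncl h𝒜 := by
  refine LinearMap.ext fun a => ?_
  change counitMap (smashJ h𝒜) (extend 𝒜.act (smashJ h𝒜) (smashIncl h𝒜)
    (a ⊗ₜ[k] smashJ h𝒜 (β k H))) = _
  rw [(smashIncl_isEquivariant h𝒜).counitMap_extend,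
    convMap_one_right (inducedAct_β (smashJ h𝒜)), counitMap_β, mul_one]

theorem smashIota_mul (a : A) (b : SmashProduct h𝒜) :
    (smashInduced h𝒜).mul (smashIota h𝒜 a) b =
      extend 𝒜.act (smashJ h𝒜) (smashIncl h𝒜) (a ⊗ₜ[k] b) := by
  have h1 := extend_comp (v := smashJ h𝒜) (γ' := counitMap (smashJ h𝒜)) (smashIota_isHLinear h𝒜)
    (a ⊗ₜ[k] b)
  rw [counitMap_smashIota] at h1
  rw [h1]
  exact inducedMul_eq_extend _ _ _

theorem smashIota_isModuleAlgebraHom :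
    IsModuleAlgebraHom 𝒜 (smashInduced h𝒜) (smashIota h𝒜) where
  map_act := smashIota_isHLinear h𝒜
  map_mul a b := by
    have h1 := (smashIncl_isEquivariant h𝒜).extend_convMap (ρ := 𝒜.act) (γ := smashIncl h𝒜)
      ((a ⊗ₜ[k] b) ⊗ₜ[k] smashJ h𝒜 (β k H))
    rw [convMap_smashIncl, associator_one_right (inducedAct_β (smashJ h𝒜)),
      extend_comp (σ := 𝒜.act) (fun h s => ?_)] at h1
    · rw [smashIota_mul]
      exact h1
    · exact h𝒜.μ_isHLinear h s
  map_one := by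
    change extend _ _ _ (𝒜.one ⊗ₜ[k] smashJ h𝒜 (β k H)) = _
    rw [extend_one_left h𝒜.act_one, smashIncl_mul_smashJ]
    rfl

/-- `Π(a ⊗ h) = ι(a) ⋆ j(h)` -/
theorem smashPi_eq_mulMap :
    smashPi h𝒜 = mulMap (smashInduced h𝒜) (smashIota h𝒜) (smashJ h𝒜).toLinearMap := by
  refine TensorProduct.ext' fun a h => ?_
  rw [mulMap_tmul, smashIota_mul, smashPi_eq_extend, LinearMap.lTensor_tmul]

end SmashFactorization

/-! ### The canonical gauge element -/

section Gauge

variable (k : Type u) (H : Type v) [Field k] [Ring H] [Algebra k H]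

/-- The algebra map `h ↦ h ⊗ 1`. -/
abbrev inl : H →ₐ[k] H ⊗[k] H := Algebra.TensorProduct.includeLeft

/-- The algebra map `h ↦ 1 ⊗ h`. -/
abbrev inr : H →ₐ[k] H ⊗[k] H := Algebra.TensorProduct.includeRight

variable {k H} in
theorem inl_mul_inr_comm (x y : H) : inl k H x * inr k H y = inr k H y * inl k H x := by
  simp

variable {k H} in
theorem inl_mul_inr_mul (x y : H) (T : H ⊗[k] H) :
    inl k H x * (inr k H y * T) = inr k H y * (inl k H x * T) := by
  rw [← mul_assoc, inl_mul_inr_comm, mul_assoc]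

variable [QuasiHopfAlgebra k H]

/-- The action `(x ⊗ (y ⊗ z)) · (p ⊗ q) = x p ⊗ y q S(z)` of `H ⊗ (H ⊗ H)` on `H ⊗ H`. -/
abbrev regAct : H ⊗[k] (H ⊗[k] H) →ₐ[k] Module.End k (H ⊗[k] H) :=
  twoAct (Algebra.lmul k H) (AlgHom.id k H)

/-- `p_R = x¹ ⊗ x² β S(x³)` -/
def elemp : H ⊗[k] H := regAct k H (Φinv k H) (1 ⊗ₜ[k] β k H)

variable {k H}

theorem regAct_tmul (x y z p q : H) : regAct k H (x ⊗ₜ[k] (y ⊗ₜ[k] z)) (p ⊗ₜ[k] q) =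
    (x * p) ⊗ₜ[k] (y * q * S k H z) := by
  simp [regAct, twoAct_tmul, biAct_tmul]

theorem sandwich_comul_regAct (D : H ⊗[k] H) (T : H ⊗[k] (H ⊗[k] H)) (s : H ⊗[k] H) :
    sandwich (Δ k H).toLinearMap ((inr k H).toLinearMap ∘ₗ S k H) D (regAct k H T s) =
      regAct k H (tensorLeft (Δ k H) D * T) s := by
  rw [map_mul, Module.End.mul_apply]
  generalize regAct k H T s = s
  induction D with
  | zero => simp
  | add X Y hX hY => simp only [map_add, LinearMap.add_apply, hX, hY]
  | tmul x y =>
  rw [sandwich_tmul, tensorLeft_tmul, AlgHom.toLinearMap_apply]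
  generalize Δ k H x = D
  induction D with
  | zero => simp
  | add X Y hX hY =>
    simp only [map_add, add_mul, TensorProduct.add_tmul, LinearMap.add_apply, hX, hY]
  | tmul p q =>
  induction s with
  | zero => simp
  | add X Y hX hY => simp only [map_add, add_mul, mul_add, hX, hY]
  | tmul m n => simp [regAct_tmul]

/-- `Δ(h₁) p_R (1 ⊗ S(h₂)) = p_R (h ⊗ 1)` -/
theorem elemp_comul (h : H) :
    sandwich (Δ k H).toLinearMap ((inr k H).toLinearMap ∘ₗ S k H) (Δ k H h) (elemp k H) =
      elemp k H * inl k H h := by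
  have h1 : ∀ (T : H ⊗[k] (H ⊗[k] H)) (s : H ⊗[k] H),
      regAct k H T (s * inl k H h) = regAct k H T s * inl k H h := by
    intro T s
    induction s with
    | zero => simp
    | add X Y hX hY => simp only [map_add, add_mul, hX, hY]
    | tmul m n =>
    induction T using tensor_induction₃ with
    | add X Y hX hY => simp only [map_add, add_mul, LinearMap.add_apply, hX, hY]
    | tmul x y z => simp [regAct_tmul, mul_assoc]
  rw [elemp, sandwich_comul_regAct, ← Φinv_mul_tensorRight, map_mul, Module.End.mul_apply, ← h1,
    regAct, ← tensorAct_induced, tensorAct_one_right (inducedAct_β (AlgHom.id k H))]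
  simp

/-- `Δ(X¹) p_R (1 ⊗ S(X²) α X³) = 1 ⊗ 1` -/
theorem elemp_antiα :
    prod2 (LinearMap.mulRight k (elemp k H) ∘ₗ (Δ k H).toLinearMap)
      ((inr k H).toLinearMap ∘ₗ antiα k H) (Φ k H) = 1 := by
  have h1 : ∀ (T : H ⊗[k] (H ⊗[k] H)) (s : H ⊗[k] H),
      prod2 (LinearMap.mulRight k s ∘ₗ (Δ k H).toLinearMap)
        ((inr k H).toLinearMap ∘ₗ antiα k H) T =
      convForm (Algebra.lmul k H) (AlgHom.id k H) (slot1 (Δ k H) T) s := by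
    intro T s
    induction T using tensor_induction₃ with
    | add X Y hX hY => simp only [map_add, LinearMap.add_apply, hX, hY]
    | tmul x y z =>
    rw [slot1_tmul, prod2_tmul, LinearMap.comp_apply, AlgHom.toLinearMap_apply,
      LinearMap.mulRight_apply]
    generalize Δ k H x = D
    induction D with
    | zero => simp
    | add X Y hX hY =>
      simp only [map_add, add_mul, TensorProduct.add_tmul, LinearMap.add_apply, hX, hY]
    | tmul p q =>
    induction s with
    | zero => simp
    | add X Y hX hY => simp only [map_add, add_mul, mul_add, hX, hY]
    | tmul m n => simp [convForm_tmul, evalAct_tmul]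
  have h2 : ∀ T : H ⊗[k] (H ⊗[k] H), convForm (Algebra.lmul k H) (AlgHom.id k H)
      (padLeft k H (Φ k H) * slot2 (Δ k H) T) (1 ⊗ₜ[k] β k H) =
      (TensorProduct.lid k H).toLinearMap.lTensor H (Algebra.TensorProduct.map (AlgHom.id k H)
        (Algebra.TensorProduct.map (ε k H) (AlgHom.id k H)) T) := by
    intro T
    induction T using tensor_induction₃ with
    | add X Y hX hY => simp only [map_add, mul_add, LinearMap.add_apply, hX, hY]
    | tmul x y z =>
      rw [padLeft_apply, slot2_tmul, Algebra.TensorProduct.tmul_mul_tmul, one_mul, convForm_tmul,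
        evalAct_mul_pure]
      have h3 := inducedAct_β (AlgHom.id k H) y
      have h4 := counitMap_β (AlgHom.id k H)
      rw [AlgHom.id_apply] at h3 h4
      rw [h3, map_smul, ← counitMap, h4]
      simp
  rw [h1, elemp, convForm_twoAct, slot1_mul_padRight, mul_assoc, convForm_slot3_mul,
    slot3_trivialComul_inv, one_mul, h2, QuasiBialgebra.reassociator_counit₂]
  change (TensorProduct.lid k H).toLinearMap.lTensor H (1 ⊗ₜ[k] (1 ⊗ₜ[k] 1)) = _
  simp [Algebra.TensorProduct.one_def]

variable (k H) in
/-- The map `T ↦ Δ(S(T¹) α T²) p_R (1 ⊗ S(T³))`. -/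
def gaugeForm : H ⊗[k] (H ⊗[k] H) →ₗ[k] H ⊗[k] H :=
  prod2 (LinearMap.mulRight k (elemp k H) ∘ₗ (Δ k H).toLinearMap ∘ₗ antiα k H)
    ((inr k H).toLinearMap ∘ₗ S k H) ∘ₗ (TensorProduct.assoc k H H H).symm.toLinearMap

theorem gaugeForm_tmul (x y z : H) : gaugeForm k H (x ⊗ₜ[k] (y ⊗ₜ[k] z)) =
    Δ k H (antiα k H (x ⊗ₜ y)) * elemp k H * inr k H (S k H z) := by
  simp [gaugeForm, prod2_tmul]

theorem gaugeForm_mul_tensorRight (T : H ⊗[k] (H ⊗[k] H)) (D : H ⊗[k] H) :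
    gaugeForm k H (T * tensorRight (Δ k H) D) =
      sandwich ((Δ k H).toLinearMap ∘ₗ S k H) (inl k H).toLinearMap D (gaugeForm k H T) := by
  induction D with
  | zero => simp
  | add X Y hX hY => simp only [map_add, mul_add, LinearMap.add_apply, hX, hY]
  | tmul d e =>
  induction T using tensor_induction₃ with
  | add X Y hX hY => simp only [map_add, add_mul, hX, hY]
  | tmul x y z =>
  have key : ∀ E : H ⊗[k] H, gaugeForm k H (x ⊗ₜ[k] (y ⊗ₜ[k] z) * (d ⊗ₜ E)) =
      Δ k H (S k H d) * Δ k H (antiα k H (x ⊗ₜ y)) *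
        sandwich (Δ k H).toLinearMap ((inr k H).toLinearMap ∘ₗ S k H) E (elemp k H) *
        inr k H (S k H z) := by
    intro E
    induction E with
    | zero => simp
    | add X Y hX hY =>
      simp only [map_add, mul_add, add_mul, TensorProduct.tmul_add, LinearMap.add_apply, hX, hY]
    | tmul p q =>
      simp only [Algebra.TensorProduct.tmul_mul_tmul, gaugeForm_tmul, sandwich_tmul, antiα_tmul,
        QuasiHopfAlgebra.antipode_mul, map_mul, AlgHom.toLinearMap_apply, LinearMap.comp_apply,
        LinearEquiv.coe_coe, mul_assoc]
  rw [tensorRight_tmul, key, elemp_comul, sandwich_tmul, gaugeForm_tmul]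
  simp only [LinearMap.comp_apply, AlgHom.toLinearMap_apply, mul_assoc, inl_mul_inr_comm]

theorem gaugeForm_tensorLeft_mul (T : H ⊗[k] (H ⊗[k] H)) (D : H ⊗[k] H) :
    gaugeForm k H (tensorLeft (Δ k H) D * T) = gaugeForm k H T * inr k H (S k H
      (TensorProduct.lid k H (Algebra.TensorProduct.map (ε k H) (AlgHom.id k H) D))) := by
  induction D with
  | zero => simp
  | add X Y hX hY => simp only [map_add, mul_add, add_mul, hX, hY]
  | tmul d e =>
  induction T using tensor_induction₃ with
  | add X Y hX hY => simp only [map_add, add_mul, mul_add, hX, hY]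
  | tmul x y z =>
  have key : ∀ E : H ⊗[k] H, gaugeForm k H (TensorProduct.assoc k H H H (E ⊗ₜ e) *
      x ⊗ₜ[k] (y ⊗ₜ[k] z)) =
      Δ k H (antiα k H (E * (x ⊗ₜ y))) * elemp k H * inr k H (S k H (e * z)) := by
    intro E
    induction E with
    | zero => simp
    | add X Y hX hY => simp only [map_add, add_mul, TensorProduct.add_tmul, hX, hY]
    | tmul p q => simp [gaugeForm_tmul]
  rw [tensorLeft_tmul, key, antiα_comul_mul, gaugeForm_tmul]
  simp [QuasiHopfAlgebra.antipode_mul, mul_assoc]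

variable (k H) in
/-- `Δ(S(x¹) α x²) p_R (1 ⊗ S(x³))` -/
def elemW : H ⊗[k] H := gaugeForm k H (Φinv k H)

/-- `Δ(S(h₁)) W (h₂ ⊗ 1) = W (1 ⊗ S(h))` for `W = Δ(S(x¹) α x²) p_R (1 ⊗ S(x³))` -/
theorem elemW_comul (h : H) :
    sandwich ((Δ k H).toLinearMap ∘ₗ S k H) (inl k H).toLinearMap (Δ k H h) (elemW k H) =
      elemW k H * inr k H (S k H h) := by
  rw [elemW, ← gaugeForm_mul_tensorRight, Φinv_mul_tensorRight, gaugeForm_tensorLeft_mul,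
    QuasiBialgebra.counit_left]
  simp

variable (k H) in
/-- The map `D ↦ Δ(S(D¹)) W (D² ⊗ 1)`. -/
def conjW : H ⊗[k] H →ₗ[k] H ⊗[k] H :=
  prod2 (LinearMap.mulRight k (elemW k H) ∘ₗ (Δ k H).toLinearMap ∘ₗ S k H) (inl k H).toLinearMap

theorem conjW_tmul (x y : H) :
    conjW k H (x ⊗ₜ[k] y) = Δ k H (S k H x) * elemW k H * inl k H y := by
  simp [conjW, prod2_tmul]

theorem conjW_apply (D : H ⊗[k] H) : conjW k H D =
    sandwich ((Δ k H).toLinearMap ∘ₗ S k H) (inl k H).toLinearMap D (elemW k H) := by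
  induction D with
  | zero => simp
  | add X Y hX hY => simp only [map_add, LinearMap.add_apply, hX, hY]
  | tmul x y => simp [conjW_tmul, sandwich_tmul]

theorem conjW_mul_inl (D : H ⊗[k] H) (h : H) :
    conjW k H (D * inl k H h) = Δ k H (S k H h) * conjW k H D := by
  induction D with
  | zero => simp
  | add X Y hX hY => simp only [map_add, mul_add, add_mul, hX, hY]
  | tmul x y => simp [conjW_tmul, QuasiHopfAlgebra.antipode_mul, mul_assoc]

theorem conjW_mul_inr (D : H ⊗[k] H) (h : H) :
    conjW k H (D * inr k H h) = conjW k H D * inl k H h := by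
  induction D with
  | zero => simp
  | add X Y hX hY => simp only [map_add, add_mul, hX, hY]
  | tmul x y => simp [conjW_tmul, mul_assoc]

theorem conjW_comul_mul (D : H ⊗[k] H) (h : H) :
    conjW k H (Δ k H h * D) = conjW k H D * inr k H (S k H h) := by
  induction D with
  | zero => simp
  | add X Y hX hY => simp only [map_add, mul_add, add_mul, hX, hY]
  | tmul x y =>
    have key : ∀ E : H ⊗[k] H, conjW k H (E * (x ⊗ₜ y)) =
        Δ k H (S k H x) * conjW k H E * inl k H y := by
      intro E
      induction E with
      | zero => simp
      | add X Y hX hY => simp only [map_add, mul_add, add_mul, hX, hY]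
      | tmul p q =>
        simp only [Algebra.TensorProduct.tmul_mul_tmul, conjW_tmul, LinearEquiv.coe_coe,
          QuasiHopfAlgebra.antipode_mul, map_mul, mul_assoc]
    rw [key, conjW_apply (Δ k H h), elemW_comul, conjW_tmul]
    simp only [mul_assoc, inl_mul_inr_comm]

theorem conjW_one : conjW k H 1 = elemW k H := by
  rw [Algebra.TensorProduct.one_def, conjW_tmul, LinearEquiv.coe_coe,
    QuasiHopfAlgebra.antipode_one, map_one, map_one, one_mul, mul_one]

variable (k H) in
/-- The map `y ⊗ z ↦ β S(z) ⊗ S(y)`. -/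
def flipβ : H ⊗[k] H →ₗ[k] H ⊗[k] H :=
  LinearMap.mulLeft k (inl k H (β k H)) ∘ₗ flipS k H

theorem flipS_tmul (x y : H) : flipS k H (x ⊗ₜ[k] y) = S k H y ⊗ₜ S k H x := by
  simp [flipS]

theorem flipS_mul (D E : H ⊗[k] H) : flipS k H (D * E) = flipS k H E * flipS k H D := by
  induction D with
  | zero => simp
  | add X Y hX hY => simp only [map_add, mul_add, add_mul, hX, hY]
  | tmul x y =>
  induction E with
  | zero => simp
  | add X Y hX hY => simp only [map_add, mul_add, add_mul, hX, hY]
  | tmul p q => simp [flipS_tmul, QuasiHopfAlgebra.antipode_mul]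

theorem flipβ_tmul (x y : H) :
    flipβ k H (x ⊗ₜ[k] y) = inl k H (β k H * S k H y) * inr k H (S k H x) := by
  simp [flipβ, flipS_tmul]

theorem flipβ_mul (D E : H ⊗[k] H) : flipβ k H (D * E) = flipβ k H E * flipS k H D := by
  simp [flipβ, flipS_mul, mul_assoc]

/-- `δ = Δ(X¹) p_R (β S(X³) ⊗ S(X²))` -/
theorem elemδ_eq : elemδ k H =
    prod2 (LinearMap.mulRight k (elemp k H) ∘ₗ (Δ k H).toLinearMap) (flipβ k H) (Φ k H) := by
  rw [elemδ, elemB, elemp]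
  generalize Φinv k H = U
  generalize Φ k H = T
  induction T using tensor_induction₃ with
  | add X Y hX hY => simp only [map_add, add_mul, LinearMap.add_apply, hX, hY]
  | tmul x y z =>
  rw [prod2_tmul, LinearMap.comp_apply, AlgHom.toLinearMap_apply, LinearMap.mulRight_apply,
    slot1_tmul]
  generalize Δ k H x = D
  induction D with
  | zero => simp
  | add X Y hX hY =>
    simp only [map_add, add_mul, TensorProduct.add_tmul, LinearMap.add_apply, hX, hY]
  | tmul d e =>
  induction U using tensor_induction₃ with
  | add X Y hX hY => simp only [map_add, add_mul, mul_add, LinearMap.add_apply, hX, hY]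
  | tmul p q r =>
    simp [padRight_tmul, regAct_tmul, flipβ_tmul, flipS_tmul, sandwich_tmul,
      QuasiHopfAlgebra.antipode_mul, mul_assoc]

variable (k H) in
/-- The map `T ↦ Δ(S(T¹) α T²) p_R (β S(T⁴) ⊗ S(T³))`. -/
def gaugeForm₄ : H ⊗[k] (H ⊗[k] (H ⊗[k] H)) →ₗ[k] H ⊗[k] H :=
  prod2 (LinearMap.mulRight k (elemp k H) ∘ₗ (Δ k H).toLinearMap ∘ₗ antiα k H) (flipβ k H) ∘ₗ
    (TensorProduct.assoc k H H (H ⊗[k] H)).symm.toLinearMap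

theorem gaugeForm₄_tmul (x y : H) (D : H ⊗[k] H) : gaugeForm₄ k H (x ⊗ₜ[k] (y ⊗ₜ[k] D)) =
    Δ k H (antiα k H (x ⊗ₜ y)) * elemp k H * flipβ k H D := by
  simp [gaugeForm₄, prod2_tmul]

/-- The element `g = f⁻¹` in terms of the left hand side of `slot3_mul_padLeft`. -/
theorem elemg_eq_gaugeForm₄ :
    elemg k H = gaugeForm₄ k H (slot3 (Δ k H) (Φinv k H) * padLeft k H (Φ k H)) := by
  rw [elemg, elemδ_eq]
  generalize Φ k H = U
  generalize Φinv k H = T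
  induction T using tensor_induction₃ with
  | add X Y hX hY => simp only [map_add, add_mul, LinearMap.add_apply, hX, hY]
  | tmul x y z =>
  induction U using tensor_induction₃ with
  | add X Y hX hY => simp only [map_add, mul_add, hX, hY]
  | tmul p q r =>
    rw [slot3_tmul, padLeft_apply, Algebra.TensorProduct.tmul_mul_tmul,
      Algebra.TensorProduct.tmul_mul_tmul, gaugeForm₄_tmul, flipβ_mul,
      TensorProduct.assoc_symm_tmul, sandwich_tmul, prod2_tmul]
    simp only [antiα_tmul, map_mul, LinearMap.comp_apply, AlgHom.toLinearMap_apply, mul_assoc,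
      LinearMap.mulRight_apply, mul_one]

/-- `Δ(S(·) α ·)` absorbs `Δ(T¹)`. -/
theorem gaugeForm₄_slot1_mul (T : H ⊗[k] (H ⊗[k] H)) (U : H ⊗[k] (H ⊗[k] (H ⊗[k] H))) :
    gaugeForm₄ k H (slot1 (Δ k H) T * U) = gaugeForm₄ k H (slot1 (trivialComul k H) T * U) := by
  induction T using tensor_induction₃ with
  | add X Y hX hY => simp only [map_add, add_mul, hX, hY]
  | tmul x y z =>
  induction U using tensor_induction₄ with
  | add X Y hX hY => simp only [map_add, mul_add, hX, hY]
  | tmul p q r s =>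
  have key : ∀ D : H ⊗[k] H,
      gaugeForm₄ k H (TensorProduct.assoc k H H (H ⊗[k] H) (D ⊗ₜ (y ⊗ₜ z)) *
        (p ⊗ₜ[k] (q ⊗ₜ[k] (r ⊗ₜ[k] s)))) =
      Δ k H (antiα k H (D * (p ⊗ₜ q))) * elemp k H * flipβ k H ((y ⊗ₜ z) * (r ⊗ₜ s)) := by
    intro D
    induction D with
    | zero => simp
    | add X Y hX hY => simp only [map_add, add_mul, TensorProduct.add_tmul, hX, hY]
    | tmul d e => simp [gaugeForm₄_tmul]
  rw [slot1_tmul, slot1_tmul, key, key, antiα_comul_mul, trivialComul_apply,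
    ← Algebra.TensorProduct.one_def, smul_mul_assoc, one_mul]
  simp only [map_smul]

theorem gaugeForm₄_padRight_mul_slot2 (T U : H ⊗[k] (H ⊗[k] H)) :
    gaugeForm₄ k H (padRight k H T * slot2 (Δ k H) U) =
      sandwich ((Δ k H).toLinearMap ∘ₗ S k H) (inl k H).toLinearMap
        (regAct k H U (1 ⊗ₜ[k] β k H)) (gaugeForm k H T) := by
  induction U using tensor_induction₃ with
  | add X Y hX hY => simp only [map_add, mul_add, LinearMap.add_apply, hX, hY]
  | tmul p q r =>
  induction T using tensor_induction₃ with
  | add X Y hX hY => simp only [map_add, add_mul, hX, hY]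
  | tmul x y z =>
  have key : ∀ E : H ⊗[k] H, gaugeForm₄ k H (x ⊗ₜ[k] (y ⊗ₜ[k] (z ⊗ₜ[k] 1)) *
        (p ⊗ₜ TensorProduct.assoc k H H H (E ⊗ₜ r))) =
      Δ k H (S k H p) * Δ k H (antiα k H (x ⊗ₜ y)) *
        sandwich (Δ k H).toLinearMap ((inr k H).toLinearMap ∘ₗ S k H) E (elemp k H) *
        inl k H (β k H * S k H r) * inr k H (S k H z) := by
    intro E
    induction E with
    | zero => simp
    | add X Y hX hY =>
      simp only [map_add, mul_add, add_mul, TensorProduct.add_tmul, TensorProduct.tmul_add,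
        LinearMap.add_apply, hX, hY]
    | tmul d e =>
      simp only [Algebra.TensorProduct.tmul_mul_tmul, TensorProduct.assoc_tmul, gaugeForm₄_tmul,
        sandwich_tmul, antiα_tmul, flipβ_tmul, one_mul,
        QuasiHopfAlgebra.antipode_mul, map_mul, AlgHom.toLinearMap_apply, LinearMap.comp_apply,
        LinearEquiv.coe_coe, mul_assoc, inl_mul_inr_comm, inl_mul_inr_mul]
  rw [padRight_tmul, slot2_tmul, key, elemp_comul, regAct_tmul, mul_one p, sandwich_tmul,
    gaugeForm_tmul]
  simp only [LinearMap.comp_apply, AlgHom.toLinearMap_apply, mul_assoc, map_mul, inl_mul_inr_comm,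
    inl_mul_inr_mul]

/-- `f⁻¹ = Δ(S(p¹)) W (p² ⊗ 1)` -/
theorem elemg_eq_conjW : elemg k H = conjW k H (elemp k H) := by
  rw [elemg_eq_gaugeForm₄, slot3_mul_padLeft, mul_assoc, gaugeForm₄_slot1_mul, slot1_trivialComul,
    one_mul, gaugeForm₄_padRight_mul_slot2, conjW_apply]
  rfl

/-- `Δ(S(h)) f⁻¹ = f⁻¹ (S ⊗ S)(Δ^cop(h))` -/
theorem comul_antipode_mul_elemg (h : H) :
    Δ k H (S k H h) * elemg k H = elemg k H * flipS k H (Δ k H h) := by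
  rw [elemg_eq_conjW, ← conjW_mul_inl, ← elemp_comul]
  generalize Δ k H h = D
  induction D with
  | zero => simp
  | add X Y hX hY => simp only [map_add, mul_add, LinearMap.add_apply, hX, hY]
  | tmul x y =>
    rw [sandwich_tmul, LinearMap.comp_apply, AlgHom.toLinearMap_apply, AlgHom.toLinearMap_apply,
      conjW_mul_inr, conjW_comul_mul, flipS_tmul, mul_assoc]
    simp

/-- `f⁻¹ (S(q²) ⊗ S(q¹)) = Δ(S(x¹) α x²) p_R (1 ⊗ S(x³))` -/
theorem elemg_mul_flipS_elemq : elemg k H * flipS k H (elemq k H) = elemW k H := by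
  rw [← conjW_one, ← elemp_antiα, elemg_eq_conjW, elemq]
  generalize Φ k H = T
  induction T using tensor_induction₃ with
  | add X Y hX hY => simp only [map_add, mul_add, hX, hY]
  | tmul x y z =>
    rw [prod2_tmul, LinearMap.comp_apply, LinearMap.comp_apply, AlgHom.toLinearMap_apply,
      AlgHom.toLinearMap_apply, LinearMap.mulRight_apply, conjW_mul_inr, conjW_comul_mul,
      mul_assoc]
    simp [prod2_tmul, flipS_tmul, antiα_tmul, QuasiHopfAlgebra.antipode_mul, mul_assoc]

end Gauge

/-! ### The exchange relation -/

section Exchange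

variable {k : Type u} {H : Type v} [Field k] [Ring H] [Algebra k H] [QuasiHopfAlgebra k H]
variable {A : Type*} [AddCommGroup A] [Module k A]

/-- The map `T ↦ Δ(T¹) D Δ(S(T²)) Z (T³ ⊗ 1)`. -/
def exchangeForm (D Z : H ⊗[k] H) : H ⊗[k] (H ⊗[k] H) →ₗ[k] H ⊗[k] H :=
  prod2 (LinearMap.mulRight k D ∘ₗ (Δ k H).toLinearMap)
    (prod2 (LinearMap.mulRight k Z ∘ₗ (Δ k H).toLinearMap ∘ₗ S k H) (inl k H).toLinearMap)

theorem exchangeForm_tmul (D Z : H ⊗[k] H) (x y z : H) :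
    exchangeForm D Z (x ⊗ₜ[k] (y ⊗ₜ[k] z)) =
      Δ k H x * D * (Δ k H (S k H y) * Z * inl k H z) := by
  simp [exchangeForm, prod2_tmul]

variable {𝒜 : HModuleData k H A} (h𝒜 : 𝒜.IsModuleAlgebra)

theorem smashIota_eq_smashEval (a : A) : smashIota h𝒜 a = smashEval h𝒜 a (elemp k H) := by
  change prod2 (smashIncl h𝒜) LinearMap.id
    (twoAct 𝒜.act (smashJ h𝒜) (Φinv k H) (a ⊗ₜ[k] smashJ h𝒜 (β k H))) = _
  rw [elemp]
  generalize Φinv k H = T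
  induction T using tensor_induction₃ with
  | add X Y hX hY => simp only [map_add, LinearMap.add_apply, hX, hY]
  | tmul x y z =>
    rw [twoAct_tmul, prod2_tmul, biAct_tmul, regAct_tmul, smashEval_tmul, mul_one,
      LinearMap.id_apply, ← map_mul, ← map_mul, smashIncl_mul_smashJ]

/-- `j(h) ⋆ ι(a)` -/
theorem smashJ_mul_smashIota (h : H) (a : A) :
    (smashInduced h𝒜).mul (smashJ h𝒜 h) (smashIota h𝒜 a) =
      smashEval h𝒜 a (exchangeForm (Δ k H h) (elemW k H) (Φ k H)) := by
  change inducedMul (smashJ h𝒜) (smashJ h𝒜 h) (smashIota h𝒜 a) = _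
  rw [inducedMul_eq_mulForm, elemW, smashIota_eq_smashEval]
  generalize Φ k H = T
  generalize Φinv k H = U
  induction T using tensor_induction₃ with
  | add X Y hX hY => simp only [map_add, mul_add, hX, hY]
  | tmul x y z =>
  induction U using tensor_induction₃ with
  | add X Y hX hY =>
    simp only [map_add, add_mul, hX, hY]
    simp only [exchangeForm_tmul, mul_add, add_mul, map_add]
  | tmul p q r =>
  have key : ∀ E : H ⊗[k] H,
      mulForm (smashJ h𝒜) (smashJ h𝒜 h) (smashEval h𝒜 a (elemp k H))
        ((1 ⊗ₜ[k] (p ⊗ₜ[k] (q ⊗ₜ[k] r))) * (x ⊗ₜ (y ⊗ₜ E))) =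
      smashEval h𝒜 a (Δ k H x * Δ k H h * (Δ k H (S k H y) * Δ k H (antiα k H (p ⊗ₜ q)) *
        sandwich (Δ k H).toLinearMap ((inr k H).toLinearMap ∘ₗ S k H) E (elemp k H) *
        inr k H (S k H r))) := by
    intro E
    induction E with
    | zero => simp
    | add X Y hX hY =>
      simp only [map_add, mul_add, add_mul, TensorProduct.tmul_add, LinearMap.add_apply, hX, hY]
    | tmul d e =>
      rw [Algebra.TensorProduct.tmul_mul_tmul, Algebra.TensorProduct.tmul_mul_tmul,
        Algebra.TensorProduct.tmul_mul_tmul, mulForm_tmul, one_mul, ← map_mul,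
        mul_assoc (smashJ h𝒜 _), smashEval_mul_smashJ, smashJ_mul_smashEval,
        smashJ_mul_smashEval]
      simp only [sandwich_tmul, antiα_tmul, QuasiHopfAlgebra.antipode_mul, map_mul,
        AlgHom.toLinearMap_apply, LinearMap.comp_apply, LinearEquiv.coe_coe, mul_assoc,
        Algebra.TensorProduct.includeRight_apply, Algebra.TensorProduct.tmul_mul_tmul, one_mul]
  rw [padLeft_apply, slot3_tmul, key, elemp_comul, exchangeForm_tmul, gaugeForm_tmul]
  simp only [mul_assoc, inl_mul_inr_comm]

/-- The formula that defines `R` is `Φ` applied to the exchange form; `Π` cancels this `Φ`. -/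
theorem coactH0_eq (h : H) : coactH0 k H h =
    regAct k H (Φ k H) (exchangeForm (Δ k H h) (elemW k H) (Φ k H)) := by
  have h1 : ∀ (T : H ⊗[k] (H ⊗[k] H)) (s : H ⊗[k] H),
      sandwich LinearMap.id ((inr k H).toLinearMap ∘ₗ S k H)
        ((TensorProduct.assoc k H H H).symm T) s = regAct k H T s := by
    intro T s
    induction s with
    | zero => simp
    | add X Y hX hY => simp only [map_add, hX, hY]
    | tmul p q =>
    induction T using tensor_induction₃ with
    | add X Y hX hY => simp only [map_add, LinearMap.add_apply, hX, hY]
    | tmul x y z => simp [regAct_tmul, sandwich_tmul]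
  have h2 : ∀ T : H ⊗[k] (H ⊗[k] H),
      sandwich (Δ k H).toLinearMap
        (prod2 (flipS k H ∘ₗ LinearMap.mulLeft k (elemq k H) ∘ₗ (Δ k H).toLinearMap)
          (inl k H).toLinearMap) T (Δ k H h * elemg k H) =
        exchangeForm (Δ k H h) (elemW k H) T := by
    intro T
    induction T using tensor_induction₃ with
    | add X Y hX hY => simp only [map_add, LinearMap.add_apply, hX, hY]
    | tmul x y z =>
      rw [sandwich_tmul, prod2_tmul, exchangeForm_tmul, ← elemg_mul_flipS_elemq,
        ← mul_assoc (Δ k H (S k H y)), comul_antipode_mul_elemg]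
      simp only [LinearMap.comp_apply, AlgHom.toLinearMap_apply, LinearMap.mulLeft_apply,
        flipS_mul, mul_assoc]
  change sandwich LinearMap.id ((inr k H).toLinearMap ∘ₗ S k H)
    ((TensorProduct.assoc k H H H).symm (Φ k H)) (sandwich (Δ k H).toLinearMap
        (prod2 (flipS k H ∘ₗ LinearMap.mulLeft k (elemq k H) ∘ₗ (Δ k H).toLinearMap)
          (inl k H).toLinearMap) (Φ k H) (Δ k H h * elemg k H)) = _
  rw [h1, h2]

/-- `Π(R(h ⊗ a)) = j(h) ⋆ ι(a)` -/
theorem smashPi_diamondTwist (h : H) (a : A) :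
    smashPi h𝒜 (diamondTwist 𝒜 (h ⊗ₜ[k] a)) =
      (smashInduced h𝒜).mul (smashJ h𝒜 h) (smashIota h𝒜 a) := by
  have h1 : diamondTwist 𝒜 (h ⊗ₜ[k] a) =
      (𝒜.act.toLinearMap.flip a).rTensor H (coactH0 k H h) := rfl
  have hlin : IsHLinear (Algebra.lmul k H) 𝒜.act (𝒜.act.toLinearMap.flip a) := by
    intro x y
    simp
  rw [smashJ_mul_smashIota, h1, coactH0_eq, smashPi, LinearMap.comp_apply, conjMap_eq_twoAct,
    ← rTensor_twoAct hlin, ← Module.End.mul_apply, ← map_mul, Units.inv_mul, map_one]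
  rfl

end Exchange

end

end QuasiHopf

theorem proposition3p2 {k H A : Type*} [Field k] [Ring H] [Algebra k H]
    [QuasiHopf.QuasiHopfAlgebra k H] [AddCommGroup A] [Module k A]
    (𝒜 : QuasiHopf.HModuleData k H A) (h𝒜 : 𝒜.IsModuleAlgebra) :
    -- `H₀` is a left `H`-module algebra and `R` is a twisting map between `A` and `H₀`, so that
    -- the twisted tensor product `A ◇ H₀` is a left `H`-module algebra
    (QuasiHopf.H0 k H).IsModuleAlgebra ∧
    QuasiHopf.IsTwistingMap 𝒜 (QuasiHopf.H0 k H) (QuasiHopf.diamondTwist 𝒜) ∧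
    (QuasiHopf.diamond 𝒜).IsModuleAlgebra ∧
    -- `(A # H)^j` is a left `H`-module algebra
    (QuasiHopf.smashInduced h𝒜).IsModuleAlgebra ∧
    -- `Π` is an isomorphism of left `H`-module algebras
    QuasiHopf.IsModuleAlgebraIso (QuasiHopf.diamond 𝒜) (QuasiHopf.smashInduced h𝒜)
      (QuasiHopf.smashPi h𝒜) := by
  have hC : (QuasiHopf.smashInduced h𝒜).IsModuleAlgebra :=
    QuasiHopf.induced_isModuleAlgebra (QuasiHopf.smashJ h𝒜)
  have hι := QuasiHopf.smashIota_isModuleAlgebraHom h𝒜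
  have hj := QuasiHopf.smashJ_isModuleAlgebraHom h𝒜
  have hPi := QuasiHopf.smashPi_eq_mulMap h𝒜
  have hbij := QuasiHopf.smashPi_bijective h𝒜
  rw [hPi] at hbij
  have hR : QuasiHopf.mulMap (QuasiHopf.smashInduced h𝒜) (QuasiHopf.smashIota h𝒜)
        (QuasiHopf.smashJ h𝒜).toLinearMap ∘ₗ QuasiHopf.diamondTwist 𝒜 =
      QuasiHopf.mulMap (QuasiHopf.smashInduced h𝒜) (QuasiHopf.smashJ h𝒜).toLinearMap
        (QuasiHopf.smashIota h𝒜) := by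
    rw [← hPi]
    exact TensorProduct.ext' (QuasiHopf.smashPi_diamondTwist h𝒜)
  have hiso := QuasiHopf.isModuleAlgebraIso_of_factorization hC hι hj hbij hR
  rw [← hPi] at hiso
  exact ⟨QuasiHopf.induced_isModuleAlgebra (AlgHom.id k H),
    QuasiHopf.isTwistingMap_of_factorization hC hι hj hbij.injective hR,
    hiso.isModuleAlgebra hC, hC, hiso⟩
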